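/- Let $N\in\mathbb N\cup\{0\}$ and $b>0$. Let $P_N$ be a complex polynomial of degree exactly $N$ with zeros $z^0_n$, $1-N\le n\le 0$, listed with multiplicity. Let $S_0$ be a sine-type function of type $b$, i.e. an entire function of exponential type for which there are positive constants $c,C,K$ with $$c<|S_0(z)|\,e^{-b|\operatorname{Im} z|}<C\qquad\text{whenever } |\operatorname{Im} z|>K .$$ Let $z^0_n$, $n\ge 1$, be the zeros of $S_0$ listed with multiplicity, and suppose that they are asymptotically simple and separated: there are $m\in\mathbb N$ and $\delta>0$ with $|z^0_n-z^0_k|\ge\delta$ for all $n,k\ge m$, $n\neq k$. Put $\mu_n:=z^0_n$ if $z^0_n\ne 0$ and $\mu_n:=-1$ if $z^0_n=0$, for $n\ge 1-N$. Then for every $w\in L_2(-b,b)$ (complex-valued) the entire function $$\theta(z)=P_N(z)S_0(z)+\int_{-b}^{b}w(x)\,e^{izx}\,dx$$ has infinitely many zeros, and all its zeros, counted with multiplicity, can be numbered as a sequence $\{z_n\}_{n\ge 1-N}$ such that $$z_n=z^0_n+\frac{\varkappa_n}{\mu_n^{N}},\quad n\ge 1-N,\qquad \sum_{n\ge 1-N}|\varkappa_n|^2<\infty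 .$$ -/

import Mathlib

open MeasureTheory

/-- `F` is a sine-type function of type `b`: an entire function of exponential type with
`c < |F(z)| exp(-b |Im z|) < C` for `|Im z| > K`, for some positive constants `c`, `C`, `K`. -/
structure IsSineType (b : ℝ) (F : ℂ → ℂ) : Prop where
  entire : Differentiable ℂ F
  expType : ∃ A B : ℝ, ∀ z : ℂ, ‖F z‖ ≤ A * Real.exp (B * ‖z‖)
  bounds : ∃ c C K : ℝ, 0 < c ∧ 0 < C ∧ 0 < K ∧ ∀ z : ℂ, K < |z.im| →
    c < ‖F z‖ * Real.exp (-(|z.im| * b)) ∧ ‖F z‖ * Real.exp (-(|z.im| * b)) < C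

/-- The family `z n`, `n ∈ I`, lists all zeros of the entire function `f`, each of them repeated
according to its multiplicity (the order of vanishing is `0` at a point that is not a zero). -/
def ListsZeros (f : ℂ → ℂ) (I : Set ℤ) (z : ℤ → ℂ) : Prop :=
  ∀ c : ℂ, {n : ℤ | n ∈ I ∧ z n = c}.encard = analyticOrderAt f c

/-- `|z n - z k|` is bounded away from zero for distinct, sufficiently large `n` and `k`. -/
def AsymptoticallySeparated (z : ℤ → ℂ) : Prop :=
  ∃ m : ℤ, ∃ δ : ℝ, 0 < δ ∧ ∀ n k : ℤ, m ≤ n → m ≤ k → n ≠ k → δ ≤ ‖z n - z k‖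

/-- The function `θ(z) = P(z) S₀(z) + ∫_{-b}^{b} w(x) exp(izx) dx`. -/
noncomputable def theta (b : ℝ) (P : Polynomial ℂ) (S₀ : ℂ → ℂ) (w : ℝ → ℂ) (z : ℂ) : ℂ :=
  P.eval z * S₀ z + ∫ x in (-b)..b, w x * Complex.exp (Complex.I * z * (x : ℂ))

open Classical in
/-- `μ n = z⁰ n` if `z⁰ n ≠ 0`, and `μ n = -1` otherwise. -/
noncomputable def mu (z₀ : ℤ → ℂ) (n : ℤ) : ℂ := if z₀ n = 0 then -1 else z₀ n

/-! Write G = P S₀ and let W be the Fourier term, so that θ = G + W. The proof weighs a lower bound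
for G against an upper bound for W, each used twice.

Away from its zeros, |S₀| is at least a constant times exp(b|Im z|) (`IsSineType.exists_le_norm`).
In the strip containing the zeros, one divides S₀ by the boundedly many zeros in a disc of fixed
radius; the quotient is zero-free, bounded, and bounded below at the centre, so Borel–Carathéodory
bounds it below on the half disc. Near a distant zero, which is simple and isolated, this becomes a
linear bound |S₀(z)| ≥ c|z - z⁰ₙ| (`IsSineType.exists_mul_norm_sub_le`).

On the other side, W is o(exp(b|Im z|)) (`exists_entireFourier_le`), and its maxima over discs of a
fixed radius about the points πk/b form an ℓ² sequence (`exists_summable_sq_bound`). The latter is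
Bessel's inequality at those points, carried to the discs by Taylor expansion.

The first bounds of each kind give |W| < |G| far out and away from the zeros. Rouché's theorem on
small circles about the distant zeros and on one large circle then produces the numbering
(`ListsZeros.exists_of_norm_sub_lt`). The second bounds give the rate: at a zero zₙ of θ one has
|P(zₙ)||S₀(zₙ)| = |W(zₙ)|, where |P(zₙ)| is at least a multiple of |z⁰ₙ|^N, so |ϰₙ| is at most a
constant times the ℓ² bound at the lattice point nearest to Re z⁰ₙ. Separation lets each lattice
point serve only boundedly many n (`AsymptoticallySeparated.summable_comp_round`). -/

/-! ### Zero multisets and factoring zeros out of entire functions -/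

/-- The monic polynomial function with the multiset of roots `M`. -/
noncomputable def rootProd (M : Multiset ℂ) (z : ℂ) : ℂ := (M.map fun a => z - a).prod

@[simp] lemma rootProd_zero (z : ℂ) : rootProd 0 z = 1 := by simp [rootProd]

@[simp] lemma rootProd_cons (a : ℂ) (M : Multiset ℂ) (z : ℂ) :
    rootProd (a ::ₘ M) z = (z - a) * rootProd M z := by simp [rootProd]

lemma rootProd_add (M M' : Multiset ℂ) (z : ℂ) :
    rootProd (M + M') z = rootProd M z * rootProd M' z := by simp [rootProd]

lemma differentiable_rootProd (M : Multiset ℂ) : Differentiable ℂ (rootProd M) := by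
  induction M using Multiset.induction_on with
  | empty =>
    have : rootProd 0 = fun _ => 1 := funext rootProd_zero
    rw [this]; fun_prop
  | cons a M ih =>
    have : rootProd (a ::ₘ M) = fun z => (z - a) * rootProd M z := funext (rootProd_cons a M)
    rw [this]; fun_prop

lemma rootProd_ne_zero {M : Multiset ℂ} {z : ℂ} (h : z ∉ M) : rootProd M z ≠ 0 := by
  refine Multiset.prod_ne_zero fun hm => ?_
  obtain ⟨a, ha, h0⟩ := Multiset.mem_map.1 hm
  exact h (by rwa [sub_eq_zero.1 h0])

lemma le_norm_rootProd {M : Multiset ℂ} {z : ℂ} {r : ℝ} (hr : 0 ≤ r)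
    (h : ∀ a ∈ M, r ≤ ‖z - a‖) : r ^ M.card ≤ ‖rootProd M z‖ := by
  induction M using Multiset.induction_on with
  | empty => simp
  | cons a M ih =>
    rw [Multiset.card_cons, pow_succ', rootProd_cons, norm_mul]
    exact mul_le_mul (h a (by simp)) (ih fun b hb => h b (by simp [hb])) (by positivity)
      (norm_nonneg _)

lemma norm_rootProd_le {M : Multiset ℂ} {z : ℂ} {r : ℝ}
    (h : ∀ a ∈ M, ‖z - a‖ ≤ r) : ‖rootProd M z‖ ≤ r ^ M.card := by
  induction M using Multiset.induction_on with
  | empty => simp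
  | cons a M ih =>
    rw [Multiset.card_cons, pow_succ', rootProd_cons, norm_mul]
    have := h a (by simp)
    exact mul_le_mul this (ih fun b hb => h b (by simp [hb])) (norm_nonneg _)
      ((norm_nonneg _).trans this)

lemma analyticOrderAt_rootProd (M : Multiset ℂ) (c : ℂ) :
    analyticOrderAt (rootProd M) c = (M.count c : ℕ∞) := by
  induction M using Multiset.induction_on with
  | empty =>
    rw [((differentiable_rootProd 0).analyticAt c).analyticOrderAt_eq_zero.2 (by simp)]
    simp
  | cons a M ih =>
    have : rootProd (a ::ₘ M) = (fun z => z - a) * rootProd M := funext (rootProd_cons a M)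
    have h1 : AnalyticAt ℂ (fun z : ℂ => z - a) c := by fun_prop
    rw [this, analyticOrderAt_mul h1 ((differentiable_rootProd M).analyticAt c), ih]
    by_cases hac : c = a
    · subst hac
      rw [analyticOrderAt_id_sub_const_self]
      simp [add_comm]
    · rw [h1.analyticOrderAt_eq_zero.2 (sub_ne_zero.2 hac), Multiset.count_cons_of_ne hac]
      simp

/-- `M` is the multiset of the zeros of `f` in `K`, counted with multiplicity. -/
structure IsZeroMultiset (f : ℂ → ℂ) (K : Set ℂ) (M : Multiset ℂ) : Prop where
  mem : ∀ a ∈ M, a ∈ K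
  count : ∀ c ∈ K, analyticOrderAt f c = (M.count c : ℕ∞)

lemma analyticOrderAt_ne_top_of_entire {f : ℂ → ℂ} (hf : Differentiable ℂ f) (h0 : ∃ z, f z ≠ 0)
    (c : ℂ) : analyticOrderAt f c ≠ ⊤ := by
  intro h
  obtain ⟨z, hz⟩ := h0
  have := (analyticOrderAt_eq_top.1 h)
  have h2 := AnalyticOnNhd.eq_of_eventuallyEq (𝕜 := ℂ) (f := f) (g := fun _ => 0)
    (fun z _ => hf.analyticAt z) (fun z _ => analyticAt_const) this
  exact hz (congrFun h2 z)

/-- Each zero is peeled off with `dslope`, which is again entire by removability of the singularity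
and whose order at `a` is one less. -/
lemma exists_eq_replicate_mul (a : ℂ) (n : ℕ) : ∀ {f : ℂ → ℂ}, Differentiable ℂ f →
    analyticOrderAt f a = n → ∃ g : ℂ → ℂ, Differentiable ℂ g ∧ g a ≠ 0 ∧
      ∀ z, f z = rootProd (Multiset.replicate n a) z * g z := by
  induction n with
  | zero =>
    intro f hf hn
    exact ⟨f, hf, (hf.analyticAt a).analyticOrderAt_eq_zero.1 (by simpa using hn), by simp⟩
  | succ n ih =>
    intro f hf hn
    have hfa : f a = 0 := by
      apply apply_eq_zero_of_analyticOrderAt_ne_zero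
      rw [hn]; simp
    have hd : Differentiable ℂ (dslope f a) := by
      have := (Complex.differentiableOn_dslope (f := f) (c := a) (s := Set.univ) (by simp)).2
        hf.differentiableOn
      exact differentiableOn_univ.1 this
    have hfd : ∀ z, f z = (z - a) * dslope f a z := fun z => by
      have := sub_smul_dslope f a z
      rw [hfa, sub_zero, smul_eq_mul] at this
      exact this.symm
    have hord : analyticOrderAt (dslope f a) a = n := by
      have h1 : AnalyticAt ℂ (fun z : ℂ => z - a) a := by fun_prop
      have h2 := analyticOrderAt_mul h1 (hd.analyticAt a)
      rw [show (fun z : ℂ => z - a) * dslope f a = f from funext fun z => (hfd z).symm, hn,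
        analyticOrderAt_id_sub_const_self] at h2
      rw [Nat.cast_succ, add_comm] at h2
      exact ENat.add_right_injective_of_ne_top ENat.one_ne_top h2.symm
    obtain ⟨g, hg, hga, hgf⟩ := ih hd hord
    refine ⟨g, hg, hga, fun z => ?_⟩
    rw [hfd, hgf, Multiset.replicate_succ, rootProd_cons, mul_assoc]

lemma exists_eq_rootProd_mul_finset (s : Finset ℂ) {f : ℂ → ℂ} (hf : Differentiable ℂ f)
    (h0 : ∃ z, f z ≠ 0) : ∃ (M : Multiset ℂ) (g : ℂ → ℂ), (∀ a ∈ M, a ∈ s) ∧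
      Differentiable ℂ g ∧ (∀ z ∈ s, g z ≠ 0) ∧ ∀ z, f z = rootProd M z * g z := by
  induction s using Finset.induction_on with
  | empty => exact ⟨0, f, by simp, hf, by simp, by simp⟩
  | insert a s _ ih =>
    obtain ⟨M, g, hM, hg, hgs, hfg⟩ := ih
    have hg0 : ∃ z, g z ≠ 0 := by
      obtain ⟨z, hz⟩ := h0
      exact ⟨z, fun h => hz (by rw [hfg, h, mul_zero])⟩
    obtain ⟨n, hn⟩ := ENat.ne_top_iff_exists.1 (analyticOrderAt_ne_top_of_entire hg hg0 a)
    obtain ⟨g', hg', hga, hgg⟩ := exists_eq_replicate_mul a n hg hn.symm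
    refine ⟨M + Multiset.replicate n a, g', ?_, hg', ?_, fun z => ?_⟩
    · intro x hx
      rcases Multiset.mem_add.1 hx with h | h
      · exact Finset.mem_insert_of_mem (hM x h)
      · rw [Multiset.eq_of_mem_replicate h]; exact Finset.mem_insert_self _ _
    · intro z hz
      rcases Finset.mem_insert.1 hz with rfl | h
      · exact hga
      · intro h'
        exact hgs z h (by rw [hgg, h', mul_zero])
    · rw [hfg, hgg, rootProd_add, mul_assoc]

lemma finite_zeros_of_isCompact {f : ℂ → ℂ} (hf : Differentiable ℂ f) (h0 : ∃ z, f z ≠ 0)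
    {K : Set ℂ} (hK : IsCompact K) : {z | z ∈ K ∧ f z = 0}.Finite := by
  obtain ⟨w, hw⟩ := h0
  have h := AnalyticOnNhd.preimage_zero_mem_codiscrete (𝕜 := ℂ) (f := f) (x := w)
    (fun z _ => hf.analyticAt z) hw
  have h2 := hK.finite_sdiff_of_mem_codiscreteWithin
    (Filter.codiscreteWithin_mono (Set.subset_univ K) h)
  refine h2.subset fun z hz => ?_
  exact ⟨hz.1, by simpa using hz.2⟩

lemma exists_eq_rootProd_mul {f : ℂ → ℂ} (hf : Differentiable ℂ f)
    (h0 : ∃ z, f z ≠ 0) {K : Set ℂ} (hK : IsCompact K) :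
    ∃ (M : Multiset ℂ) (g : ℂ → ℂ), IsZeroMultiset f K M ∧
      Differentiable ℂ g ∧ (∀ z ∈ K, g z ≠ 0) ∧ ∀ z, f z = rootProd M z * g z := by
  have hfin := finite_zeros_of_isCompact hf h0 hK
  obtain ⟨M, g, hM, hg, hgs, hfg⟩ := exists_eq_rootProd_mul_finset hfin.toFinset hf h0
  have hgK : ∀ z ∈ K, g z ≠ 0 := fun z hz h => by
    have : z ∈ hfin.toFinset := by
      rw [Set.Finite.mem_toFinset]
      exact ⟨hz, by rw [hfg, h, mul_zero]⟩
    exact hgs z this h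
  refine ⟨M, g, ⟨fun a ha => ?_, fun c hc => ?_⟩, hg, hgK, hfg⟩
  · exact ((Set.Finite.mem_toFinset _).1 (hM a ha)).1
  · rw [show f = rootProd M * g from funext hfg,
      analyticOrderAt_mul ((differentiable_rootProd M).analyticAt c) (hg.analyticAt c),
      (hg.analyticAt c).analyticOrderAt_eq_zero.2 (hgK c hc), add_zero, analyticOrderAt_rootProd]

lemma IsZeroMultiset.unique {f : ℂ → ℂ} {K : Set ℂ} {M M' : Multiset ℂ}
    (h : IsZeroMultiset f K M) (h' : IsZeroMultiset f K M') : M = M' := by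
  ext c
  by_cases hc : c ∈ K
  · exact_mod_cast (h.count c hc).symm.trans (h'.count c hc)
  · rw [Multiset.count_eq_zero_of_notMem fun hm => hc (h.mem c hm),
      Multiset.count_eq_zero_of_notMem fun hm => hc (h'.mem c hm)]

lemma IsZeroMultiset.exists_eq_mul {f : ℂ → ℂ} (hf : Differentiable ℂ f)
    (h0 : ∃ z, f z ≠ 0) {K : Set ℂ} (hK : IsCompact K) {M : Multiset ℂ}
    (h : IsZeroMultiset f K M) : ∃ g : ℂ → ℂ,
      Differentiable ℂ g ∧ (∀ z ∈ K, g z ≠ 0) ∧ ∀ z, f z = rootProd M z * g z := by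
  obtain ⟨M', g, h', hg⟩ := exists_eq_rootProd_mul hf h0 hK
  rw [h.unique h']
  exact ⟨g, hg⟩

lemma IsZeroMultiset.mem_iff {f : ℂ → ℂ} (hf : Differentiable ℂ f) {K : Set ℂ} {M : Multiset ℂ}
    (h : IsZeroMultiset f K M) {c : ℂ} : c ∈ M ↔ c ∈ K ∧ f c = 0 := by
  constructor
  · intro hc
    refine ⟨h.mem c hc, apply_eq_zero_of_analyticOrderAt_ne_zero ?_⟩
    rw [h.count c (h.mem c hc)]
    exact_mod_cast (Multiset.count_pos.2 hc).ne'
  · rintro ⟨hc, h0⟩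
    have := (hf.analyticAt c).analyticOrderAt_ne_zero.2 h0
    rw [h.count c hc] at this
    exact Multiset.count_pos.1 (Nat.pos_of_ne_zero (by exact_mod_cast this))

/-- The indices landing in `K` split into the fibres over the distinct elements of `M`. This turns
pointwise multiplicities into the total counts that Rouché's theorem compares. -/
lemma encard_eq_card_of_count {I : Set ℤ} {z : ℤ → ℂ} {K : Set ℂ} {M : Multiset ℂ}
    (hM : ∀ a ∈ M, a ∈ K)
    (h : ∀ c ∈ K, {n : ℤ | n ∈ I ∧ z n = c}.encard = (M.count c : ℕ∞)) :
    {n : ℤ | n ∈ I ∧ z n ∈ K}.encard = (M.card : ℕ∞) := by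
  have hU : {n : ℤ | n ∈ I ∧ z n ∈ K} = ⋃ c ∈ (M.toFinset : Set ℂ), {n : ℤ | n ∈ I ∧ z n = c} := by
    ext n
    simp only [Set.mem_iUnion, Finset.mem_coe, Multiset.mem_toFinset]
    constructor
    · rintro ⟨hn, hz⟩
      refine ⟨z n, ?_, hn, rfl⟩
      have h1 := h (z n) hz
      have h2 : {k : ℤ | k ∈ I ∧ z k = z n}.encard ≠ 0 :=
        Set.encard_ne_zero.2 ⟨n, hn, rfl⟩
      rw [h1] at h2
      exact Multiset.count_pos.1 (Nat.pos_of_ne_zero (by exact_mod_cast h2))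
    · rintro ⟨c, hc, hn, hz⟩
      exact ⟨hn, hz ▸ hM c hc⟩
  rw [hU, Set.Finite.encard_biUnion (Finset.finite_toSet _), finsum_mem_coe_finset,
    Finset.sum_congr rfl fun c hc => h c (hM c (Multiset.mem_toFinset.1 hc)),
    ← Multiset.toFinset_sum_count_eq M, Nat.cast_sum]
  intro a _ c _ hac
  refine Set.disjoint_left.2 ?_
  rintro n ⟨_, h1⟩ ⟨_, h2⟩
  exact hac (h1.symm.trans h2)

lemma ListsZeros.encard_eq {f : ℂ → ℂ} {I : Set ℤ} {z : ℤ → ℂ} (hz : ListsZeros f I z)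
    {K : Set ℂ} {M : Multiset ℂ} (h : IsZeroMultiset f K M) :
    {n : ℤ | n ∈ I ∧ z n ∈ K}.encard = (M.card : ℕ∞) :=
  encard_eq_card_of_count h.mem fun c hc => (hz c).trans (h.count c hc)

lemma ListsZeros.apply_eq_zero {f : ℂ → ℂ} {I : Set ℤ} {z : ℤ → ℂ} (hz : ListsZeros f I z)
    {n : ℤ} (hn : n ∈ I) : f (z n) = 0 := by
  apply apply_eq_zero_of_analyticOrderAt_ne_zero
  rw [← hz (z n)]
  exact Set.encard_ne_zero.2 ⟨n, hn, rfl⟩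

lemma ListsZeros.exists_of_eq_zero {f : ℂ → ℂ} (hf : Differentiable ℂ f) {I : Set ℤ} {z : ℤ → ℂ}
    (hz : ListsZeros f I z) {c : ℂ} (hc : f c = 0) : ∃ n ∈ I, z n = c := by
  have := (hf.analyticAt c).analyticOrderAt_ne_zero.2 hc
  rw [← hz c] at this
  exact Set.encard_ne_zero.1 this

lemma ListsZeros.mul {f g : ℂ → ℂ} (hf : Differentiable ℂ f) (hg : Differentiable ℂ g)
    {I J : Set ℤ} (hIJ : Disjoint I J) {z : ℤ → ℂ} (hI : ListsZeros f I z)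
    (hJ : ListsZeros g J z) : ListsZeros (fun z => f z * g z) (I ∪ J) z := by
  intro c
  rw [show (fun z => f z * g z) = f * g from rfl,
    analyticOrderAt_mul (hf.analyticAt c) (hg.analyticAt c), ← hI c, ← hJ c,
    ← Set.encard_union_eq]
  · congr 1
    ext n
    exact or_and_right
  · refine Set.disjoint_left.2 ?_
    rintro n ⟨h1, _⟩ ⟨h2, _⟩
    exact Set.disjoint_left.1 hIJ h1 h2

/-! ### Argument principle and Rouché's theorem -/

lemma logDeriv_sub_const (a z : ℂ) : logDeriv (fun z => z - a) z = (z - a)⁻¹ := by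
  simp [logDeriv_apply]

lemma continuousOn_logDeriv {f : ℂ → ℂ} (hf : Differentiable ℂ f) {s : Set ℂ}
    (h : ∀ z ∈ s, f z ≠ 0) : ContinuousOn (logDeriv f) s := by
  intro z hz
  have h1 : ContinuousAt (deriv f) z := ((hf.analyticAt z).deriv).continuousAt
  exact (h1.div (hf z).continuousAt (h z hz)).continuousWithinAt

/-- The argument principle on a disc, for a function factored as a polynomial times a function
without zeros. -/
lemma circleIntegral_logDeriv_rootProd_mul {c : ℂ} {r : ℝ} (hr : 0 < r) {g : ℂ → ℂ}
    (hg : Differentiable ℂ g) (hg0 : ∀ z ∈ Metric.closedBall c r, g z ≠ 0) (M : Multiset ℂ)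
    (hM : ∀ a ∈ M, a ∈ Metric.ball c r) :
    (∮ z in C(c, r), logDeriv (fun z => rootProd M z * g z) z) =
      M.card * (2 * Real.pi * Complex.I) := by
  induction M using Multiset.induction_on with
  | empty =>
    simp only [rootProd_zero, one_mul, Multiset.card_zero, Nat.cast_zero, zero_mul]
    refine Complex.circleIntegral_eq_zero_of_differentiable_on_off_countable hr.le
      Set.countable_empty (continuousOn_logDeriv hg hg0) fun z hz => ?_
    have hz' := Metric.ball_subset_closedBall hz.1
    exact ((hg.analyticAt z).deriv.div (hg.analyticAt z) (hg0 z hz')).differentiableAt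
  | cons a M ih =>
    have hM' : ∀ b ∈ M, b ∈ Metric.ball c r := fun b hb => hM b (by simp [hb])
    have ha : a ∈ Metric.ball c r := hM a (by simp)
    have hns : ∀ b ∈ Metric.ball c r, ∀ z ∈ Metric.sphere c r, z ≠ b := by
      rintro b hb z hz rfl
      rw [Metric.mem_ball] at hb; rw [Metric.mem_sphere] at hz; exact hb.ne hz
    have hrd : Differentiable ℂ fun z => rootProd M z * g z := (differentiable_rootProd M).mul hg
    have hne : ∀ z ∈ Metric.sphere c r, rootProd M z * g z ≠ 0 := fun z hz =>
      mul_ne_zero (rootProd_ne_zero fun h => hns z (hM' z h) z hz rfl)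
        (hg0 z (Metric.sphere_subset_closedBall hz))
    have h1 : (∮ z in C(c, r), logDeriv (fun z => rootProd (a ::ₘ M) z * g z) z) =
        ∮ z in C(c, r), ((z - a)⁻¹ + logDeriv (fun z => rootProd M z * g z) z) := by
      refine circleIntegral.integral_congr hr.le fun z hz => ?_
      simp only [rootProd_cons, mul_assoc]
      rw [logDeriv_mul (f := fun z => z - a) z (sub_ne_zero.2 (hns a ha z hz)) (hne z hz) (by fun_prop) (hrd z),
        logDeriv_sub_const]
    rw [h1, circleIntegral.integral_add, ih hM', circleIntegral.integral_sub_inv_of_mem_ball ha]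
    · push_cast [Multiset.card_cons]; ring
    · refine ContinuousOn.circleIntegrable hr.le ?_
      exact ContinuousOn.inv₀ (by fun_prop) fun z hz => sub_ne_zero.2 (hns a ha z hz)
    · exact (continuousOn_logDeriv hrd hne).circleIntegrable hr.le

/-- On the circle `f / g` stays in the unit disc about 1, inside the slit plane, so `log (f / g)` is
a single-valued primitive of the difference of the logarithmic derivatives. -/
lemma circleIntegral_logDeriv_eq {c : ℂ} {r : ℝ} (hr : 0 < r) {f g : ℂ → ℂ}
    (hf : Differentiable ℂ f) (hg : Differentiable ℂ g)
    (h : ∀ z ∈ Metric.sphere c r, ‖f z - g z‖ < ‖g z‖) :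
    (∮ z in C(c, r), logDeriv f z) = ∮ z in C(c, r), logDeriv g z := by
  have hg0 : ∀ z ∈ Metric.sphere c r, g z ≠ 0 := fun z hz h0 => by
    have := h z hz
    rw [h0, norm_zero] at this
    exact absurd this (norm_nonneg _).not_gt
  have hf0 : ∀ z ∈ Metric.sphere c r, f z ≠ 0 := fun z hz h0 => by
    have := h z hz
    rw [h0, zero_sub, norm_neg] at this
    exact this.false
  rw [← sub_eq_zero, ← circleIntegral.integral_sub
    ((continuousOn_logDeriv hf hf0).circleIntegrable hr.le)
    ((continuousOn_logDeriv hg hg0).circleIntegrable hr.le)]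
  refine circleIntegral.integral_eq_zero_of_hasDerivWithinAt
    (f := fun z => Complex.log (f z / g z)) hr.le fun z hz => ?_
  have hs : f z / g z ∈ Complex.slitPlane := by
    refine Complex.ball_one_subset_slitPlane ?_
    rw [Metric.mem_ball, dist_eq_norm, div_sub_one (hg0 z hz), norm_div,
      div_lt_one (norm_pos_iff.2 (hg0 z hz))]
    exact h z hz
  have hd := (((hf z).hasDerivAt.div (hg z).hasDerivAt (hg0 z hz)).clog hs).hasDerivWithinAt
    (s := Metric.sphere c r)
  refine hd.congr_deriv ?_
  have h1 := hf0 z hz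
  have h2 := hg0 z hz
  change (deriv f z * g z - f z * deriv g z) / g z ^ 2 / (f z / g z) =
    deriv f z / f z - deriv g z / g z
  field_simp

/-- **Rouché's theorem** on a disc, for entire functions. -/
theorem rouche_card_eq {c : ℂ} {r : ℝ} (hr : 0 < r) {f g : ℂ → ℂ}
    (hf : Differentiable ℂ f) (hg : Differentiable ℂ g)
    (h : ∀ z ∈ Metric.sphere c r, ‖f z - g z‖ < ‖g z‖) {M M' : Multiset ℂ}
    (hM : IsZeroMultiset f (Metric.closedBall c r) M)
    (hM' : IsZeroMultiset g (Metric.closedBall c r) M') : M.card = M'.card := by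
  have hg0 : ∀ z ∈ Metric.sphere c r, g z ≠ 0 := fun z hz h0 => by
    have := h z hz
    rw [h0, norm_zero] at this
    exact absurd this (norm_nonneg _).not_gt
  have hf0 : ∀ z ∈ Metric.sphere c r, f z ≠ 0 := fun z hz h0 => by
    have := h z hz
    rw [h0, zero_sub, norm_neg] at this
    exact this.false
  obtain ⟨p, hp⟩ : (Metric.sphere c r).Nonempty := NormedSpace.sphere_nonempty.2 hr.le
  have key : ∀ {u : ℂ → ℂ} {U : Multiset ℂ}, Differentiable ℂ u →
      (∀ z ∈ Metric.sphere c r, u z ≠ 0) → IsZeroMultiset u (Metric.closedBall c r) U →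
      (∮ z in C(c, r), logDeriv u z) = U.card * (2 * Real.pi * Complex.I) := by
    intro u U hu hu0 hU
    obtain ⟨v, hv, hv0, huv⟩ := hU.exists_eq_mul hu ⟨p, hu0 p hp⟩ (isCompact_closedBall c r)
    rw [show u = fun z => rootProd U z * v z from funext huv]
    refine circleIntegral_logDeriv_rootProd_mul hr hv hv0 U fun a ha => ?_
    obtain ⟨ha1, ha2⟩ := (hU.mem_iff hu).1 ha
    rcases (Metric.mem_closedBall.1 ha1).lt_or_eq with h3 | h3
    · exact Metric.mem_ball.2 h3
    · exact absurd ha2 (hu0 a h3)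
  have h2 := circleIntegral_logDeriv_eq hr hf hg h
  rw [key hf hf0 hM, key hg hg0 hM'] at h2
  have h3 := mul_right_cancel₀ Complex.two_pi_I_ne_zero h2
  exact_mod_cast h3

/-! ### Upper and lower bounds for sine-type functions -/

lemma AsymptoticallySeparated.exists_encard_le {z : ℤ → ℂ} (hz : AsymptoticallySeparated z)
    (a : ℤ) (R : ℝ) :
    ∃ B : ℕ, ∀ c : ℂ, {n : ℤ | n ∈ Set.Ici a ∧ ‖z n - c‖ ≤ R}.encard ≤ B := by
  obtain ⟨m, δ, hδ, h⟩ := hz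
  set s := δ / 2 with hs
  have hs0 : 0 < s := by positivity
  let T : Finset (ℤ × ℤ) := Finset.Icc (⌊-R / s⌋) (⌊R / s⌋) ×ˢ Finset.Icc (⌊-R / s⌋) (⌊R / s⌋)
  refine ⟨(Finset.Ico a m).card + T.card, fun c => ?_⟩
  have hsub : {n : ℤ | n ∈ Set.Ici a ∧ ‖z n - c‖ ≤ R} ⊆
      (Finset.Ico a m : Set ℤ) ∪ {n : ℤ | m ≤ n ∧ ‖z n - c‖ ≤ R} := by
    rintro n ⟨h1, h2⟩
    rcases lt_or_ge n m with h3 | h3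
    · left; simpa using ⟨h1, h3⟩
    · right; exact ⟨h3, h2⟩
  refine (Set.encard_le_encard hsub).trans ((Set.encard_union_le _ _).trans ?_)
  push_cast
  refine add_le_add (by rw [← Finset.coe_Ico, Set.encard_coe_eq_coe_finsetCard]) ?_
  rw [← Set.encard_coe_eq_coe_finsetCard]
  -- Pigeonhole on a square grid of side δ/2: two points in one cell are less than δ apart, so each
  -- cell holds at most one term of index at least `m`. The number of cells does not depend on `c`.
  refine Set.encard_le_encard_of_injOn (f := fun n => (⌊(z n - c).re / s⌋, ⌊(z n - c).im / s⌋))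
    ?_ ?_
  · rintro n ⟨_, h2⟩
    have h3 := abs_le.1 ((Complex.abs_re_le_norm (z n - c)).trans h2)
    have h4 := abs_le.1 ((Complex.abs_im_le_norm (z n - c)).trans h2)
    simp only [T, Finset.coe_product, Finset.coe_Icc, Set.mem_prod, Set.mem_Icc]
    refine ⟨⟨?_, ?_⟩, ?_, ?_⟩ <;> refine Int.floor_le_floor ?_ <;>
      refine div_le_div_of_nonneg_right ?_ hs0.le
    exacts [h3.1, h3.2, h4.1, h4.2]
  · rintro n ⟨hn, _⟩ k ⟨hk, _⟩ hnk
    simp only [Prod.mk.injEq] at hnk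
    by_contra hne
    have h1 := h n k hn hk hne
    have h2 := Int.abs_sub_lt_one_of_floor_eq_floor hnk.1
    have h3 := Int.abs_sub_lt_one_of_floor_eq_floor hnk.2
    rw [← sub_div, abs_div, abs_of_pos hs0, div_lt_one hs0] at h2 h3
    have h4 := Complex.norm_le_abs_re_add_abs_im (z n - z k)
    have h5 : (z n - z k).re = (z n - c).re - (z k - c).re := by simp
    have h6 : (z n - z k).im = (z n - c).im - (z k - c).im := by simp
    rw [h5, h6] at h4
    linarith

lemma exists_eq_mul_exp_of_ne_zero {p : ℂ} {R : ℝ} (hR : 0 < R) {g : ℂ → ℂ}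
    (hg : DifferentiableOn ℂ g (Metric.ball p R)) (h0 : ∀ z ∈ Metric.ball p R, g z ≠ 0) :
    ∃ h : ℂ → ℂ, DifferentiableOn ℂ h (Metric.ball p R) ∧ h p = 0 ∧
      ∀ z ∈ Metric.ball p R, g z = g p * Complex.exp (h z) := by
  have hL : DifferentiableOn ℂ (logDeriv g) (Metric.ball p R) :=
    (hg.deriv Metric.isOpen_ball).div hg h0
  obtain ⟨h, hp, hh⟩ := hL.isExactOn_ball.with_val_at p 0
  refine ⟨h, fun z hz => (hh z hz).differentiableAt.differentiableWithinAt, hp, fun z hz => ?_⟩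
  have hd : ∀ z ∈ Metric.ball p R, HasDerivAt (fun z => g z * Complex.exp (-h z)) 0 z := by
    intro z hz
    have h1 := (hg.differentiableAt (Metric.isOpen_ball.mem_nhds hz)).hasDerivAt
    have h2 := h1.mul (hh z hz).neg.cexp
    refine h2.congr_deriv ?_
    have := h0 z hz
    rw [logDeriv_apply]
    field_simp
    ring
  have hc := Metric.isOpen_ball.is_const_of_deriv_eq_zero (convex_ball p R).isPreconnected
    (fun z hz => (hd z hz).differentiableAt.differentiableWithinAt)
    (fun z hz => (hd z hz).deriv) hz (Metric.mem_ball_self hR)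
  simp only [hp, neg_zero, Complex.exp_zero, mul_one] at hc
  rw [← hc, mul_assoc, ← Complex.exp_add]
  simp

/-- A Harnack-type estimate: a holomorphic logarithm of `g / g p` vanishes at `p` and has real part
at most log(B/c), so Borel–Carathéodory bounds its modulus on the half disc. -/
lemma le_norm_of_ne_zero_of_norm_le {p : ℂ} {R B c : ℝ} (hR : 0 < R) {g : ℂ → ℂ}
    (hg : DifferentiableOn ℂ g (Metric.ball p R)) (h0 : ∀ z ∈ Metric.ball p R, g z ≠ 0)
    (hB : ∀ z ∈ Metric.ball p R, ‖g z‖ ≤ B) (hc : 0 < c) (hcp : c ≤ ‖g p‖) {z : ℂ}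
    (hz : ‖z - p‖ ≤ R / 2) :
    c * Real.exp (-(2 * (Real.log (B / c) + 1))) ≤ ‖g z‖ := by
  obtain ⟨h, hh, hhp, hgh⟩ := exists_eq_mul_exp_of_ne_zero hR hg h0
  have hp := Metric.mem_ball_self (x := p) hR
  have hcB : c ≤ B := hcp.trans (hB p hp)
  have hB0 : 0 < B := hc.trans_le hcB
  have hL : 0 ≤ Real.log (B / c) := Real.log_nonneg ((one_le_div hc).2 hcB)
  -- The added 1 makes the bound on the real part strictly positive even when B = c.
  set L := Real.log (B / c) + 1 with hLdef
  have hmem : ∀ u ∈ Metric.ball (0 : ℂ) R, u + p ∈ Metric.ball p R := by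
    intro u hu
    simpa [dist_eq_norm] using hu
  have hu : z - p ∈ Metric.ball (0 : ℂ) R := by
    rw [mem_ball_zero_iff]; linarith
  have key := Complex.borelCaratheodory_zero (f := fun u => h (u + p)) (M := L) (by linarith)
    (R := R) (z := z - p)
    (hh.comp (by fun_prop) hmem) (fun u hu => ?_) hR hu (by simpa using hhp)
  · simp only [sub_add_cancel] at key
    have h1 : 2 * L * ‖z - p‖ / (R - ‖z - p‖) ≤ 2 * L := by
      rw [div_le_iff₀ (by linarith)]
      have : 0 ≤ L := by linarith
      nlinarith
    rw [hgh z (by simpa [dist_eq_norm] using hu), norm_mul, Complex.norm_exp]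
    refine mul_le_mul hcp (Real.exp_le_exp.2 ?_) (Real.exp_pos _).le (norm_nonneg _)
    have := (abs_le.1 (Complex.abs_re_le_norm (h z))).1
    linarith
  · have h1 := hB _ (hmem u hu)
    rw [hgh _ (hmem u hu), norm_mul, Complex.norm_exp] at h1
    have h2 : Real.exp (h (u + p)).re ≤ B / c := by
      rw [le_div_iff₀ hc]
      refine le_trans ?_ h1
      rw [mul_comm]
      exact mul_le_mul_of_nonneg_right hcp (Real.exp_pos _).le
    have h3 : (h (u + p)).re ≤ Real.log (B / c) :=
      (Real.le_log_iff_exp_le (by positivity)).2 h2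
    change (h (u + p)).re ≤ L
    linarith

/-- Phragmén–Lindelöf in a strip widened until its boundary lines lie where the two-sided bounds
hold. -/
lemma IsSineType.exists_bound_strip {b : ℝ} {F : ℂ → ℂ} (hF : IsSineType b F) (H : ℝ) :
    ∃ C : ℝ, ∀ z : ℂ, |z.im| ≤ H → ‖F z‖ ≤ C := by
  obtain ⟨c, C, K, hc, hC, hK, hb⟩ := hF.bounds
  obtain ⟨A, B, hAB⟩ := hF.expType
  set h := max H (K + 1) with hh
  have hhK : K < h := (lt_add_one K).trans_le (le_max_right _ _)
  have hh0 : 0 < h := hK.trans hhK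
  have hline : ∀ z : ℂ, |z.im| = h → ‖F z‖ ≤ C * Real.exp (h * b) := by
    intro z hz
    have h1 := (hb z (hz ▸ hhK)).2.le
    rw [hz, Real.exp_neg, ← div_eq_mul_inv, div_le_iff₀ (Real.exp_pos _)] at h1
    exact h1
  refine ⟨C * Real.exp (h * b), fun z hz => ?_⟩
  have hz' := abs_le.1 (hz.trans (le_max_left H (K + 1)))
  refine PhragmenLindelof.horizontal_strip (a := -h) (b := h) hF.entire.diffContOnCl ?_
    (fun z hz => hline z ?_) (fun z hz => hline z ?_) hz'.1 hz'.2
  -- Half the critical rate of the strip; exponential type is far below the doubly exponential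
  -- growth allowed.
  · set c' := Real.pi / (h - -h) / 2 with hc'
    have hc'0 : 0 < c' := by
      have := Real.pi_pos
      have : 0 < h - -h := by linarith
      positivity
    refine ⟨c', half_lt_self (by linarith), |B| * (c'⁻¹ + h), ?_⟩
    refine Asymptotics.IsBigO.of_bound |A| ?_
    refine Filter.eventually_inf_principal.2 (Filter.Eventually.of_forall fun z hz => ?_)
    refine (hAB z).trans ?_
    rw [Real.norm_eq_abs, abs_of_pos (Real.exp_pos _)]
    refine mul_le_mul (le_abs_self A) (Real.exp_le_exp.2 ?_) (Real.exp_pos _).le (abs_nonneg A)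
    have h1 : ‖z‖ ≤ |z.re| + h := (Complex.norm_le_abs_re_add_abs_im z).trans
      (add_le_add le_rfl (abs_le.2 ⟨hz.1.le, hz.2.le⟩))
    have h2 : c' * |z.re| + 1 ≤ Real.exp (c' * |z.re|) := Real.add_one_le_exp _
    have h3 : 1 ≤ Real.exp (c' * |z.re|) := Real.one_le_exp (by positivity)
    have h4 : |z.re| ≤ c'⁻¹ * Real.exp (c' * |z.re|) := by
      rw [inv_mul_eq_div, le_div_iff₀ hc'0]; linarith
    calc B * ‖z‖ ≤ |B| * ‖z‖ := mul_le_mul_of_nonneg_right (le_abs_self B) (norm_nonneg z)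
      _ ≤ |B| * (|z.re| + h) := mul_le_mul_of_nonneg_left h1 (abs_nonneg B)
      _ ≤ |B| * (c'⁻¹ * Real.exp (c' * |z.re|) + h * Real.exp (c' * |z.re|)) := by
        refine mul_le_mul_of_nonneg_left (add_le_add h4 ?_) (abs_nonneg B)
        exact le_mul_of_one_le_right hh0.le h3
      _ = |B| * (c'⁻¹ + h) * Real.exp (c' * |z.re|) := by ring
  · rw [hz, abs_neg, abs_of_pos hh0]
  · rw [hz, abs_of_pos hh0]

lemma IsSineType.exists_ne_zero {b : ℝ} {F : ℂ → ℂ} (hF : IsSineType b F) :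
    ∃ K : ℝ, ∀ z : ℂ, K < |z.im| → F z ≠ 0 := by
  obtain ⟨c, C, K, hc, hC, hK, hb⟩ := hF.bounds
  refine ⟨K, fun z hz h0 => ?_⟩
  have := (hb z hz).1
  rw [h0, norm_zero, zero_mul] at this
  exact hc.not_gt this

lemma IsSineType.exists_ne {b : ℝ} {F : ℂ → ℂ} (hF : IsSineType b F) : ∃ z, F z ≠ 0 := by
  obtain ⟨K, hK⟩ := hF.exists_ne_zero
  exact ⟨((|K| + 1 : ℝ) : ℂ) * Complex.I, hK _ (by
    simp only [Complex.mul_I_im, Complex.ofReal_re]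
    rw [abs_of_pos (by positivity)]
    linarith [le_abs_self K])⟩

/-- A sine-type function with asymptotically separated zeros is bounded below by a multiple of
`exp (b |Im z|)` away from its zeros. -/
lemma IsSineType.exists_le_norm {b : ℝ} (hb : 0 ≤ b) {F : ℂ → ℂ} (hF : IsSineType b F)
    {z₀ : ℤ → ℂ} {a : ℤ} (hz₀ : ListsZeros F (Set.Ici a) z₀) (hsep : AsymptoticallySeparated z₀)
    {ε : ℝ} (hε : 0 < ε) :
    ∃ c : ℝ, 0 < c ∧ ∀ z : ℂ, (∀ n, a ≤ n → ε ≤ ‖z - z₀ n‖) →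
      c * Real.exp (b * |z.im|) ≤ ‖F z‖ := by
  obtain ⟨c, C, K, hc, hC, hK, hbd⟩ := hF.bounds
  -- Chosen so that a point with |Im z| ≤ K is within R/2 of the point with the same real part and
  -- imaginary part K + 1.
  set R := 4 * K + 4 with hR
  have hR1 : 1 ≤ R := by linarith
  -- This strip contains the disc of radius 2R about such a centre.
  obtain ⟨B, hB⟩ := hF.exists_bound_strip (K + 1 + 2 * R)
  obtain ⟨m, hm⟩ := hsep.exists_encard_le a R
  set c₁ := c / R ^ m with hc₁
  have hc₁0 : 0 < c₁ := by positivity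
  set κ := min ε 1 ^ m * (c₁ * Real.exp (-(2 * (Real.log (B / c₁) + 1)))) with hκ
  have hε1 : 0 < min ε 1 := lt_min hε one_pos
  have hκ0 : 0 < κ := by positivity
  refine ⟨min c (κ * Real.exp (-(b * K))), by positivity, fun z hz => ?_⟩
  rcases lt_or_ge K |z.im| with h | h
  · have h1 := (hbd z h).1.le
    rw [Real.exp_neg, ← div_eq_mul_inv, le_div_iff₀ (Real.exp_pos _), mul_comm |z.im|] at h1
    exact (mul_le_mul_of_nonneg_right (min_le_left _ _) (Real.exp_pos _).le).trans h1
  refine (mul_le_mul_of_nonneg_right (min_le_right _ _) (Real.exp_pos _).le).trans ?_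
  rw [mul_assoc, ← Real.exp_add]
  refine (mul_le_of_le_one_right hκ0.le (Real.exp_le_one_iff.2 ?_)).trans ?_
  · have := mul_le_mul_of_nonneg_left h hb
    linarith
  set p : ℂ := ⟨z.re, K + 1⟩ with hp
  obtain ⟨M, g, hM, hg, hg0, hFg⟩ := exists_eq_rootProd_mul hF.entire hF.exists_ne
    (isCompact_closedBall p R)
  have hcard : M.card ≤ m := by
    have h1 := hz₀.encard_eq hM
    have h2 := hm p
    simp only [Metric.mem_closedBall, dist_eq_norm] at h1
    rw [h1] at h2
    exact_mod_cast h2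
  have hMz : ∀ x ∈ M, ‖p - x‖ ≤ R ∧ ∃ n, a ≤ n ∧ z₀ n = x := by
    intro x hx
    obtain ⟨h1, h2⟩ := (hM.mem_iff hF.entire).1 hx
    rw [Metric.mem_closedBall, dist_comm, dist_eq_norm] at h1
    exact ⟨h1, hz₀.exists_of_eq_zero hF.entire h2⟩
  -- Maximum principle on the doubled disc: on its boundary every factor v - x has modulus at least
  -- R ≥ 1, so dividing out the zeros does not increase the bound.
  have hgB : ∀ u ∈ Metric.closedBall p (2 * R), ‖g u‖ ≤ B := by
    intro u hu
    have hR2 : (2 * R) ≠ 0 := by positivity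
    rw [← closure_ball p hR2] at hu
    refine Complex.norm_le_of_forall_mem_frontier_norm_le Metric.isBounded_ball
      hg.diffContOnCl (fun v hv => ?_) hu
    rw [frontier_ball p hR2, mem_sphere_iff_norm] at hv
    have h1 : 1 ≤ ‖rootProd M v‖ := by
      refine le_trans (by simp) (le_norm_rootProd (r := 1) zero_le_one fun x hx => ?_)
      have h2 := (hMz x hx).1
      have h3 := norm_sub_le_norm_sub_add_norm_sub v x p
      rw [norm_sub_rev x p] at h3
      linarith
    have h2 : ‖F v‖ ≤ B := by
      refine hB v ?_
      have h3 := (Complex.abs_im_le_norm (v - p)).trans hv.le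
      have h4 : v.im = (v - p).im + (K + 1) := by simp [hp]
      rw [h4]
      refine (abs_add_le _ _).trans ?_
      rw [abs_of_pos (show 0 < K + 1 by linarith)]
      linarith
    rw [hFg, norm_mul] at h2
    exact (le_mul_of_one_le_left (norm_nonneg _) h1).trans h2
  have hgp : c₁ ≤ ‖g p‖ := by
    have hpim : |p.im| = K + 1 := abs_of_pos (by simp only [hp]; linarith)
    have h1 := (hbd p (by rw [hpim]; linarith)).1.le
    have h2 : c ≤ ‖F p‖ := by
      refine h1.trans (mul_le_of_le_one_right (norm_nonneg _) (Real.exp_le_one_iff.2 ?_))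
      have := mul_nonneg (abs_nonneg p.im) hb
      linarith
    have h3 : ‖rootProd M p‖ ≤ R ^ m :=
      (norm_rootProd_le fun x hx => (hMz x hx).1).trans (pow_le_pow_right₀ hR1 hcard)
    rw [hFg, norm_mul] at h2
    rw [hc₁, div_le_iff₀ (by positivity), mul_comm]
    exact h2.trans (mul_le_mul_of_nonneg_right h3 (norm_nonneg _))
  have hzp : ‖z - p‖ ≤ R / 2 := by
    have h1 : (z - p).re = 0 := by simp [hp]
    have h2 : (z - p).im = z.im - (K + 1) := by simp [hp]
    have h3 := Complex.norm_le_abs_re_add_abs_im (z - p)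
    rw [h1, h2, abs_zero] at h3
    have h4 := abs_le.1 h
    have h5 : |z.im - (K + 1)| ≤ R / 2 := abs_le.2 ⟨by linarith, by linarith⟩
    linarith
  have hgz := le_norm_of_ne_zero_of_norm_le (p := p) (R := R) (B := B) (by positivity)
    hg.differentiableOn (fun u hu => hg0 u (Metric.ball_subset_closedBall hu))
    (fun u hu => hgB u (Metric.closedBall_subset_closedBall (by linarith)
      (Metric.ball_subset_closedBall hu))) hc₁0 hgp hzp
  rw [hFg, norm_mul]
  refine mul_le_mul ?_ hgz (by positivity) (norm_nonneg _)
  refine le_trans (pow_le_pow_of_le_one hε1.le (min_le_right _ _) hcard)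
    (le_norm_rootProd hε1.le fun x hx => ?_)
  obtain ⟨n, hn, rfl⟩ := (hMz x hx).2
  exact (min_le_left _ _).trans (hz n hn)

/-! ### Growth and square summability of the Fourier transform -/

/-- The Fourier transform `∫_{-b}^{b} w(x) exp(izx) dx` as an entire function of `z`. -/
noncomputable def entireFourier (b : ℝ) (w : ℝ → ℂ) (z : ℂ) : ℂ :=
  ∫ x in (-b)..b, w x * Complex.exp (Complex.I * z * (x : ℂ))

lemma norm_exp_I_mul_le {b x : ℝ} (hx : |x| ≤ b) (z : ℂ) :
    ‖Complex.exp (Complex.I * z * (x : ℂ))‖ ≤ Real.exp (b * ‖z‖) := by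
  rw [Complex.norm_exp]
  refine Real.exp_le_exp.2 ((Complex.re_le_norm _).trans ?_)
  rw [norm_mul, norm_mul, Complex.norm_I, one_mul, Complex.norm_real, Real.norm_eq_abs, mul_comm]
  exact mul_le_mul_of_nonneg_right hx (norm_nonneg z)

lemma abs_le_of_mem_uIoc {b x : ℝ} (hb : 0 < b) (hx : x ∈ Set.uIoc (-b) b) : |x| ≤ b := by
  rw [Set.uIoc_of_le (by linarith)] at hx
  exact abs_le.2 ⟨hx.1.le, hx.2⟩

lemma differentiable_entireFourier {b : ℝ} (hb : 0 < b) {w : ℝ → ℂ}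
    (hw : IntervalIntegrable w volume (-b) b) : Differentiable ℂ (entireFourier b w) := by
  intro z₀
  have hexp : ∀ z : ℂ, Continuous fun x : ℝ => Complex.exp (Complex.I * z * (x : ℂ)) :=
    fun z => by fun_prop
  have hdexp : ∀ z : ℂ, Continuous fun x : ℝ =>
      Complex.I * (x : ℂ) * Complex.exp (Complex.I * z * (x : ℂ)) := fun z => by fun_prop
  have hwm := hw.def'.aestronglyMeasurable
  have h := intervalIntegral.hasDerivAt_integral_of_dominated_loc_of_deriv_le (μ := volume)
    (a := -b) (b := b) (s := Metric.ball z₀ 1)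
    (F := fun z x => w x * Complex.exp (Complex.I * z * (x : ℂ)))
    (F' := fun z x => w x * (Complex.I * (x : ℂ) * Complex.exp (Complex.I * z * (x : ℂ))))
    (x₀ := z₀) (bound := fun x => ‖w x‖ * (b * Real.exp (b * (‖z₀‖ + 1))))
    (Metric.ball_mem_nhds z₀ one_pos)
    (Filter.Eventually.of_forall fun z => hwm.mul (hexp z).aestronglyMeasurable)
    (hw.mul_continuousOn (hexp z₀).continuousOn)
    (hwm.mul (hdexp z₀).aestronglyMeasurable)
    (Filter.Eventually.of_forall fun x hx z hz => ?_)
    (hw.norm.mul_const _)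
    (Filter.Eventually.of_forall fun x _ z _ => ?_)
  · exact h.2.differentiableAt
  · have hxb := abs_le_of_mem_uIoc hb hx
    rw [norm_mul, norm_mul, norm_mul, Complex.norm_I, one_mul, Complex.norm_real, Real.norm_eq_abs]
    refine mul_le_mul_of_nonneg_left (mul_le_mul hxb ((norm_exp_I_mul_le hxb z).trans
      (Real.exp_le_exp.2 (mul_le_mul_of_nonneg_left ?_ hb.le))) (norm_nonneg _) hb.le)
      (norm_nonneg _)
    rw [Metric.mem_ball, dist_eq_norm] at hz
    have := norm_le_norm_add_norm_sub' z z₀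
    linarith
  · have h1 : HasDerivAt (fun z : ℂ => Complex.I * z * (x : ℂ)) (Complex.I * (x : ℂ)) z := by
      simpa using ((hasDerivAt_id z).const_mul Complex.I).mul_const (x : ℂ)
    have h2 := (h1.cexp).const_mul (w x)
    refine h2.congr_deriv ?_
    ring

/-- After division by exp(b|Im z|), the kernel is dominated by exp(-s(b-x)) + exp(-s(b+x)) with s =
|Im z|, one term for each sign of Im z. It tends to 0 inside the interval, and dominated convergence
applies. -/
lemma exists_entireFourier_le_of_le_abs_im {b : ℝ} (hb : 0 < b) {w : ℝ → ℂ}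
    (hw : IntervalIntegrable w volume (-b) b) {η : ℝ} (hη : 0 < η) :
    ∃ Y : ℝ, ∀ z : ℂ, Y ≤ |z.im| → ‖entireFourier b w z‖ ≤ η * Real.exp (b * |z.im|) := by
  have hcont : ∀ s : ℝ, Continuous fun x : ℝ =>
      Real.exp (-(s * (b - x))) + Real.exp (-(s * (b + x))) := fun s => by fun_prop
  have hlim : Filter.Tendsto (fun s : ℝ => ∫ x in (-b)..b,
      ‖w x‖ * (Real.exp (-(s * (b - x))) + Real.exp (-(s * (b + x))))) Filter.atTop
      (nhds (∫ x in (-b)..b, (0 : ℝ))) := by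
    refine intervalIntegral.tendsto_integral_filter_of_dominated_convergence
      (fun x => ‖w x‖ * 2) ?_ ?_ (hw.norm.mul_const _) ?_
    · exact Filter.Eventually.of_forall fun s =>
        hw.def'.aestronglyMeasurable.norm.mul (hcont s).aestronglyMeasurable
    · filter_upwards [Filter.eventually_ge_atTop 0] with s hs
      refine Filter.Eventually.of_forall fun x hx => ?_
      have hxb := abs_le.1 (abs_le_of_mem_uIoc hb hx)
      rw [norm_mul, norm_norm]
      refine mul_le_mul_of_nonneg_left ?_ (norm_nonneg _)
      rw [Real.norm_eq_abs, abs_of_pos (by positivity)]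
      have h1 : Real.exp (-(s * (b - x))) ≤ 1 := Real.exp_le_one_iff.2
        (neg_nonpos.2 (mul_nonneg hs (by linarith)))
      have h2 : Real.exp (-(s * (b + x))) ≤ 1 := Real.exp_le_one_iff.2
        (neg_nonpos.2 (mul_nonneg hs (by linarith)))
      linarith
    · have hne : ∀ᵐ x : ℝ, x ≠ b := by
        simp [ae_iff, measure_singleton]
      filter_upwards [hne] with x hxne hx
      rw [Set.uIoc_of_le (by linarith)] at hx
      have hlt : x < b := lt_of_le_of_ne hx.2 hxne
      have key : ∀ t : ℝ, 0 < t →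
          Filter.Tendsto (fun s : ℝ => Real.exp (-(s * t))) Filter.atTop (nhds 0) := fun t ht =>
        Real.tendsto_exp_neg_atTop_nhds_zero.comp (Filter.tendsto_id.atTop_mul_const ht)
      have := ((key (b - x) (by linarith)).add (key (b + x) (by linarith [hx.1]))).const_mul ‖w x‖
      simpa using this
  rw [intervalIntegral.integral_zero] at hlim
  obtain ⟨Y, hY⟩ := Filter.eventually_atTop.1 (hlim.eventually (gt_mem_nhds hη))
  refine ⟨Y, fun z hz => ?_⟩
  have h1 := (hY _ hz).le
  rw [mul_comm]
  refine le_trans ?_ (mul_le_mul_of_nonneg_left h1 (Real.exp_pos (b * |z.im|)).le)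
  rw [← intervalIntegral.integral_const_mul, entireFourier]
  refine intervalIntegral.norm_integral_le_of_norm_le (by linarith)
    (Filter.Eventually.of_forall fun x _ => ?_)
    ((hw.norm.mul_continuousOn (hcont _).continuousOn).const_mul _)
  rw [norm_mul, mul_left_comm]
  refine mul_le_mul_of_nonneg_left ?_ (norm_nonneg _)
  rw [mul_add, ← Real.exp_add, ← Real.exp_add, Complex.norm_exp]
  have h2 : (Complex.I * z * (x : ℂ)).re = -(z.im * x) := by simp
  rw [h2]
  rcases abs_cases z.im with ⟨h, _⟩ | ⟨h, _⟩
  · refine le_trans (Real.exp_le_exp.2 (le_of_eq ?_)) (le_add_of_nonneg_left (Real.exp_pos _).le)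
    rw [h]; ring
  · refine le_trans (Real.exp_le_exp.2 (le_of_eq ?_)) (le_add_of_nonneg_right (Real.exp_pos _).le)
    rw [h]; ring

/-- Cauchy–Schwarz with weights `a j` gives (∑ a v)² ≤ (∑ a)(∑ a v²); summing over `k` first then
uses the bound `Q`, uniform in `j`. -/
lemma summable_sq_tsum_of_nonneg {ι : Type*} {a : ℕ → ℝ} (ha : ∀ j, 0 ≤ a j) (hs : Summable a)
    {v : ℕ → ι → ℝ} (hv : ∀ j k, 0 ≤ v j k) {Q : ℝ}
    (hQ : ∀ (j : ℕ) (s : Finset ι), ∑ k ∈ s, v j k ^ 2 ≤ Q) :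
    Summable fun k => (∑' j, a j * v j k) ^ 2 := by
  have hv2 : ∀ j k, v j k ^ 2 ≤ Q := fun j k => by simpa using hQ j {k}
  have hQ0 : 0 ≤ Q := by simpa using hQ 0 ∅
  have hs2 : ∀ k, Summable fun j => a j * v j k ^ 2 := fun k =>
    Summable.of_nonneg_of_le (fun j => mul_nonneg (ha j) (sq_nonneg _))
      (fun j => mul_le_mul_of_nonneg_left (hv2 j k) (ha j)) (hs.mul_right Q)
  have hs1 : ∀ k, Summable fun j => a j * v j k := fun k => by
    refine Summable.of_nonneg_of_le (fun j => mul_nonneg (ha j) (hv j k))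
      (fun j => mul_le_mul_of_nonneg_left (?_ : v j k ≤ Q + 1) (ha j)) (hs.mul_right _)
    nlinarith [hv2 j k, sq_nonneg (v j k - 1)]
  have hCS : ∀ k, (∑' j, a j * v j k) ^ 2 ≤ (∑' j, a j) * ∑' j, a j * v j k ^ 2 := by
    intro k
    refine le_of_tendsto (((hs1 k).hasSum).pow 2) (Filter.Eventually.of_forall fun J => ?_)
    refine (Finset.sum_sq_le_sum_mul_sum_of_sq_le_mul J (f := a)
      (g := fun j => a j * v j k ^ 2) (fun j _ => ha j)
      (fun j _ => mul_nonneg (ha j) (sq_nonneg _)) (fun j _ => le_of_eq (by ring))).trans ?_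
    exact mul_le_mul (hs.sum_le_tsum J fun j _ => ha j)
      ((hs2 k).sum_le_tsum J fun j _ => mul_nonneg (ha j) (sq_nonneg _))
      (Finset.sum_nonneg fun j _ => mul_nonneg (ha j) (sq_nonneg _)) (tsum_nonneg ha)
  refine summable_of_sum_le (c := (∑' j, a j) * ((∑' j, a j) * Q)) (fun k => sq_nonneg _)
    fun s => ?_
  calc ∑ k ∈ s, (∑' j, a j * v j k) ^ 2
      ≤ ∑ k ∈ s, (∑' j, a j) * ∑' j, a j * v j k ^ 2 := Finset.sum_le_sum fun k _ => hCS k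
    _ = (∑' j, a j) * ∑' j, a j * ∑ k ∈ s, v j k ^ 2 := by
      rw [← Finset.mul_sum, ← Summable.tsum_finsetSum fun k _ => hs2 k]
      simp_rw [Finset.mul_sum]
    _ ≤ (∑' j, a j) * ((∑' j, a j) * Q) := by
      refine mul_le_mul_of_nonneg_left ?_ (tsum_nonneg ha)
      rw [← tsum_mul_right]
      refine Summable.tsum_le_tsum (fun j => mul_le_mul_of_nonneg_left (hQ j s) (ha j)) ?_
        (hs.mul_right Q)
      exact Summable.of_nonneg_of_le
        (fun j => mul_nonneg (ha j) (Finset.sum_nonneg fun k _ => sq_nonneg _))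
        (fun j => mul_le_mul_of_nonneg_left (hQ j s) (ha j)) (hs.mul_right Q)

/-- **Bessel's inequality** for the values of the Fourier transform at the points `π k / b`. -/
lemma sum_sq_entireFourier_le {b : ℝ} (hb : 0 < b) {w : ℝ → ℂ}
    (hw : MemLp w 2 (volume.restrict (Set.Ioc (-b) b))) (s : Finset ℤ) :
    ∑ k ∈ s, ‖entireFourier b w ((Real.pi * k / b : ℝ) : ℂ)‖ ^ 2 ≤
      2 * b * ∫ x in (-b)..b, ‖w x‖ ^ 2 := by
  have hab : -b < b := by linarith
  have h1 := hasSum_sq_fourierCoeffOn hab hw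
  -- The index is `-k` because Fourier coefficients integrate against the conjugate exponential.
  have h2 : ∀ k : ℤ, entireFourier b w ((Real.pi * k / b : ℝ) : ℂ) =
      (2 * b : ℝ) * fourierCoeffOn hab w (-k) := by
    intro k
    rw [fourierCoeffOn_eq_integral, Complex.real_smul, ← mul_assoc, ← Complex.ofReal_mul,
      show 2 * b * (1 / (b - -b)) = 1 by field_simp; ring, Complex.ofReal_one, one_mul,
      entireFourier]
    refine intervalIntegral.integral_congr fun x _ => ?_
    simp only [neg_neg, smul_eq_mul, fourier_coe_apply]
    rw [mul_comm]
    congr 2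
    have : (b : ℂ) ≠ 0 := by exact_mod_cast hb.ne'
    push_cast
    field_simp
    ring
  have h3 : ∀ k : ℤ, ‖entireFourier b w ((Real.pi * k / b : ℝ) : ℂ)‖ ^ 2 =
      (2 * b) ^ 2 * ‖fourierCoeffOn hab w (-k)‖ ^ 2 := by
    intro k
    rw [h2, norm_mul, mul_pow, Complex.norm_real, Real.norm_eq_abs, sq_abs]
  have h4 : HasSum (fun k : ℤ => ‖fourierCoeffOn hab w (-k)‖ ^ 2)
      ((b - -b)⁻¹ • ∫ x in (-b)..b, ‖w x‖ ^ 2) :=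
    ((Equiv.neg ℤ).hasSum_iff (f := fun i => ‖fourierCoeffOn hab w i‖ ^ 2)).2 h1
  simp_rw [h3]
  rw [← Finset.mul_sum]
  refine (mul_le_mul_of_nonneg_left (sum_le_hasSum s (fun k _ => by positivity) h4)
    (by positivity)).trans (le_of_eq ?_)
  rw [smul_eq_mul]
  field_simp
  ring

/-- The series of exp(iζx) is integrated term by term. Each Taylor coefficient is again a Fourier
transform, of x^j w, to which Bessel's inequality applies. -/
lemma hasSum_entireFourier_add {b : ℝ} (hb : 0 < b) {w : ℝ → ℂ}
    (hw : IntervalIntegrable w volume (-b) b) (z ζ : ℂ) :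
    HasSum (fun j : ℕ => (Complex.I * ζ) ^ j / j.factorial *
      entireFourier b (fun x => (x : ℂ) ^ j * w x) z) (entireFourier b w (z + ζ)) := by
  have hexp : Continuous fun x : ℝ => Complex.exp (Complex.I * z * (x : ℂ)) := by fun_prop
  have h := intervalIntegral.hasSum_integral_of_dominated_convergence (μ := volume)
    (a := -b) (b := b)
    (F := fun (j : ℕ) (x : ℝ) => (Complex.I * ζ) ^ j / j.factorial *
      ((x : ℂ) ^ j * w x * Complex.exp (Complex.I * z * (x : ℂ))))
    (f := fun x => w x * Complex.exp (Complex.I * (z + ζ) * (x : ℂ)))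
    (fun j x => (‖ζ‖ * b) ^ j / j.factorial * (‖w x‖ * Real.exp (b * ‖z‖))) ?_ ?_ ?_ ?_ ?_
  · simp only [intervalIntegral.integral_const_mul] at h
    exact h
  · intro j
    have hc : Continuous fun x : ℝ => (x : ℂ) ^ j := by fun_prop
    exact ((hc.aestronglyMeasurable.mul hw.def'.aestronglyMeasurable).mul
      hexp.aestronglyMeasurable).const_mul _
  · intro j
    refine Filter.Eventually.of_forall fun x hx => ?_
    have hxb := abs_le_of_mem_uIoc hb hx
    simp only [norm_mul, norm_div, norm_pow, mul_pow, Complex.norm_I, one_pow, one_mul, Complex.norm_real,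
      Real.norm_eq_abs, Complex.norm_natCast]
    have h1 : |x| ^ j ≤ b ^ j := pow_le_pow_left₀ (abs_nonneg x) hxb j
    have h2 := norm_exp_I_mul_le hxb z
    calc ‖ζ‖ ^ j / j.factorial * (|x| ^ j * ‖w x‖ * ‖Complex.exp (Complex.I * z * (x : ℂ))‖)
        ≤ ‖ζ‖ ^ j / j.factorial * (b ^ j * ‖w x‖ * Real.exp (b * ‖z‖)) := by gcongr
      _ = _ := by ring
  · exact Filter.Eventually.of_forall fun x _ =>
      (Real.summable_pow_div_factorial _).mul_right _
  · simp_rw [tsum_mul_right]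
    exact (hw.norm.mul_const _).const_mul _
  · refine Filter.Eventually.of_forall fun x _ => ?_
    have h1 : HasSum (fun j : ℕ => (Complex.I * ζ * x) ^ j / j.factorial)
        (Complex.exp (Complex.I * ζ * x)) := by
      rw [Complex.exp_eq_exp_ℂ]
      exact NormedSpace.expSeries_div_hasSum_exp _
    have h2 := h1.mul_left (w x * Complex.exp (Complex.I * z * (x : ℂ)))
    rw [mul_assoc (w x), ← Complex.exp_add] at h2
    rw [show Complex.I * (z + ζ) * (x : ℂ) = Complex.I * z * x + Complex.I * ζ * x by ring]
    refine (congrArg (fun F : ℕ → ℂ => HasSum F _) (funext fun j => ?_)).mpr h2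
    rw [mul_pow _ (x : ℂ)]
    ring

lemma MemLp.intervalIntegrable_of_restrict_Ioc {b : ℝ} (hb : 0 < b) {w : ℝ → ℂ}
    (hw : MemLp w 2 (volume.restrict (Set.Ioc (-b) b))) :
    IntervalIntegrable w volume (-b) b := by
  rw [intervalIntegrable_iff_integrableOn_Ioc_of_le (by linarith)]
  exact hw.integrable (by norm_num)

/-- The maxima of the Fourier transform of a square integrable function over the discs of a fixed
radius centred at the points `π k / b` are square summable. -/
lemma exists_summable_sq_bound {b : ℝ} (hb : 0 < b) {w : ℝ → ℂ}
    (hw : MemLp w 2 (volume.restrict (Set.Ioc (-b) b))) {R : ℝ} (hR : 0 ≤ R) :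
    ∃ g : ℤ → ℝ, (∀ k, 0 ≤ g k) ∧ (Summable fun k => g k ^ 2) ∧
      ∀ (k : ℤ) (z : ℂ), ‖z - ((Real.pi * k / b : ℝ) : ℂ)‖ ≤ R → ‖entireFourier b w z‖ ≤ g k := by
  have hwi := MemLp.intervalIntegrable_of_restrict_Ioc hb hw
  set a : ℕ → ℝ := fun j => (R * b) ^ j / j.factorial with ha
  have ha0 : ∀ j, 0 ≤ a j := fun j => by positivity
  have has : Summable a := Real.summable_pow_div_factorial _
  -- Scaling x by b keeps |x/b|^j ≤ 1, so the Bessel bound is uniform in `j`; the powers of b move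
  -- into the summable weights `a`.
  set f : ℕ → ℝ → ℂ := fun j x => (((x / b : ℝ) : ℂ) ^ j * w x) with hf
  have hfn : ∀ j x, x ∈ Set.Ioc (-b) b → ‖f j x‖ ≤ ‖w x‖ := by
    intro j x hx
    simp only [hf, norm_mul, norm_pow, Complex.norm_real, Real.norm_eq_abs]
    refine mul_le_of_le_one_left (norm_nonneg _) (pow_le_one₀ (abs_nonneg _) ?_)
    rw [abs_div, abs_of_pos hb, div_le_one hb]
    exact abs_le.2 ⟨hx.1.le, hx.2⟩
  have hf2 : ∀ j, MemLp (f j) 2 (volume.restrict (Set.Ioc (-b) b)) := by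
    intro j
    have hc : Continuous fun x : ℝ => (((x / b : ℝ) : ℂ) ^ j) := by fun_prop
    refine hw.mono (hc.aestronglyMeasurable.mul hw.1) ?_
    exact (ae_restrict_iff' measurableSet_Ioc).2 (Filter.Eventually.of_forall (hfn j))
  set v : ℕ → ℤ → ℝ := fun j k => ‖entireFourier b (f j) ((Real.pi * k / b : ℝ) : ℂ)‖ with hv
  have hQ : ∀ (j : ℕ) (s : Finset ℤ), ∑ k ∈ s, v j k ^ 2 ≤ 2 * b * ∫ x in (-b)..b, ‖w x‖ ^ 2 := by
    intro j s
    refine (sum_sq_entireFourier_le hb (hf2 j) s).trans ?_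
    refine mul_le_mul_of_nonneg_left ?_ (by positivity)
    refine intervalIntegral.integral_mono_on_of_le_Ioo (by linarith) ?_ ?_ fun x hx => ?_
    · rw [intervalIntegrable_iff_integrableOn_Ioc_of_le (by linarith)]
      exact (hf2 j).integrable_norm_pow (by norm_num)
    · rw [intervalIntegrable_iff_integrableOn_Ioc_of_le (by linarith)]
      exact hw.integrable_norm_pow (by norm_num)
    · exact pow_le_pow_left₀ (norm_nonneg _) (hfn j x (Set.Ioo_subset_Ioc_self hx)) 2
  have hv0 : ∀ j k, 0 ≤ v j k := fun j k => norm_nonneg _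
  have hv1 : ∀ k, Summable fun j => a j * v j k := fun k => by
    have hv2 : ∀ j, v j k ^ 2 ≤ 2 * b * ∫ x in (-b)..b, ‖w x‖ ^ 2 := fun j => by
      simpa using hQ j {k}
    refine Summable.of_nonneg_of_le (fun j => mul_nonneg (ha0 j) (hv0 j k))
      (fun j => mul_le_mul_of_nonneg_left
        (?_ : v j k ≤ 2 * b * (∫ x in (-b)..b, ‖w x‖ ^ 2) + 1) (ha0 j)) (has.mul_right _)
    nlinarith [hv2 j, sq_nonneg (v j k - 1)]
  refine ⟨fun k => ∑' j, a j * v j k, fun k => tsum_nonneg fun j => mul_nonneg (ha0 j) (hv0 j k),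
    summable_sq_tsum_of_nonneg ha0 has hv0 hQ, fun k z hz => ?_⟩
  set p : ℂ := ((Real.pi * k / b : ℝ) : ℂ) with hp
  have hs := hasSum_entireFourier_add hb hwi p (z - p)
  rw [add_sub_cancel] at hs
  refine hs.norm_le_of_bounded (hv1 k).hasSum fun j => ?_
  have hb' : (b : ℂ) ≠ 0 := by exact_mod_cast hb.ne'
  have h1 : entireFourier b (fun x => (x : ℂ) ^ j * w x) p = (b : ℂ) ^ j * entireFourier b (f j) p := by
    simp only [entireFourier, ← intervalIntegral.integral_const_mul, hf]
    refine intervalIntegral.integral_congr fun x _ => ?_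
    simp only [Complex.ofReal_div, div_pow]
    field_simp
  rw [h1]
  simp only [norm_mul, norm_div, norm_pow, mul_pow, Complex.norm_I, one_pow, one_mul, Complex.norm_real,
    Real.norm_eq_abs, Complex.norm_natCast, abs_of_pos hb, ha]
  calc ‖z - p‖ ^ j / j.factorial * (b ^ j * ‖entireFourier b (f j) p‖)
      ≤ R ^ j / j.factorial * (b ^ j * ‖entireFourier b (f j) p‖) := by gcongr
    _ = _ := by ring

lemma norm_sub_round_le {b : ℝ} (hb : 0 < b) {H : ℝ} {z : ℂ} (hz : |z.im| ≤ H) :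
    ‖z - ((Real.pi * (round (b * z.re / Real.pi) : ℤ) / b : ℝ) : ℂ)‖ ≤ Real.pi / b + H := by
  refine (Complex.norm_le_abs_re_add_abs_im _).trans (add_le_add ?_ ?_)
  · have h1 := abs_sub_round (b * z.re / Real.pi)
    have hpi := Real.pi_pos
    have h2 : (z - ((Real.pi * (round (b * z.re / Real.pi) : ℤ) / b : ℝ) : ℂ)).re =
        Real.pi / b * (b * z.re / Real.pi - round (b * z.re / Real.pi)) := by
      rw [Complex.sub_re, Complex.ofReal_re]
      field_simp
    rw [h2, abs_mul, abs_of_pos (by positivity)]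
    exact mul_le_of_le_one_right (by positivity) (h1.trans (by norm_num))
  · simpa using hz

/-- The Fourier transform of a square integrable function on `(-b, b)` is
`o(exp (b |Im z|))` as `z → ∞`. -/
lemma exists_entireFourier_le {b : ℝ} (hb : 0 < b) {w : ℝ → ℂ}
    (hw : MemLp w 2 (volume.restrict (Set.Ioc (-b) b))) {η : ℝ} (hη : 0 < η) :
    ∃ T : ℝ, ∀ z : ℂ, T ≤ ‖z‖ → ‖entireFourier b w z‖ ≤ η * Real.exp (b * |z.im|) := by
  have hwi := MemLp.intervalIntegrable_of_restrict_Ioc hb hw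
  obtain ⟨Y, hY⟩ := exists_entireFourier_le_of_le_abs_im hb hwi hη
  set R := Real.pi / b + |Y| with hR
  have hR0 : 0 ≤ R := by have := Real.pi_pos; positivity
  obtain ⟨g, hg0, hgs, hg⟩ := exists_summable_sq_bound hb hw hR0
  -- In the strip only finitely many lattice discs can violate the bound, and they lie in a bounded
  -- region.
  have hfin : {k : ℤ | ¬ g k ^ 2 < η ^ 2}.Finite :=
    hgs.tendsto_cofinite_zero.eventually (gt_mem_nhds (by positivity))
  obtain ⟨D, hD⟩ := (hfin.image fun k : ℤ => |Real.pi * k / b|).bddAbove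
  refine ⟨D + R + 1, fun z hz => ?_⟩
  rcases le_total Y |z.im| with h | h
  · exact hY z h
  have h1 := norm_sub_round_le hb (h.trans (le_abs_self Y))
  set k := round (b * z.re / Real.pi) with hk
  refine (hg k z h1).trans ?_
  have h2 : g k < η := by
    by_contra hcon
    have hmem : k ∈ {k : ℤ | ¬ g k ^ 2 < η ^ 2} := fun hlt =>
      hcon (lt_of_pow_lt_pow_left₀ 2 hη.le hlt)
    have h3 := hD (Set.mem_image_of_mem _ hmem)
    have h4 := norm_le_norm_add_norm_sub' z ((Real.pi * k / b : ℝ) : ℂ)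
    rw [Complex.norm_real, Real.norm_eq_abs] at h4
    linarith
  exact h2.le.trans (le_mul_of_one_le_right hη.le (Real.one_le_exp (by positivity)))

/-! ### Isolation of distant zeros and circles avoiding them -/

lemma AsymptoticallySeparated.exists_lt_norm {z : ℤ → ℂ} (hz : AsymptoticallySeparated z)
    (R : ℝ) : ∃ n₁ : ℤ, ∀ n, n₁ ≤ n → R < ‖z n‖ := by
  obtain ⟨B, hB⟩ := hz.exists_encard_le 0 R
  have hfin : {n : ℤ | n ∈ Set.Ici 0 ∧ ‖z n - 0‖ ≤ R}.Finite :=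
    Set.finite_of_encard_le_coe (hB 0)
  obtain ⟨m, hm⟩ := hfin.bddAbove
  refine ⟨max 0 (m + 1), fun n hn => ?_⟩
  by_contra hcon
  have h1 : n ≤ m := hm ⟨(le_max_left _ _).trans hn, by simpa using hcon⟩
  have h2 := (le_max_right 0 (m + 1)).trans hn
  omega

/-- The finitely many initial terms are bounded while the sequence tends to infinity, so distant
terms are separated from these too. -/
lemma AsymptoticallySeparated.exists_le_norm_sub {z : ℤ → ℂ} (hz : AsymptoticallySeparated z)
    (a : ℤ) : ∃ (n₁ : ℤ) (δ : ℝ), 0 < δ ∧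
      ∀ n k, n₁ ≤ n → a ≤ k → k ≠ n → δ ≤ ‖z n - z k‖ := by
  obtain ⟨m, δ, hδ, h⟩ := id hz
  obtain ⟨D, hD⟩ := ((Set.finite_Ico a m).image fun k => ‖z k‖).bddAbove
  obtain ⟨n₁, hn₁⟩ := hz.exists_lt_norm (D + δ)
  refine ⟨max n₁ m, δ, hδ, fun n k hn hk hkn => ?_⟩
  rcases le_or_gt m k with hmk | hmk
  · exact h n k ((le_max_right _ _).trans hn) hmk hkn.symm
  · have h1 := hD (Set.mem_image_of_mem (fun k => ‖z k‖) (Set.mem_Ico.2 ⟨hk, hmk⟩))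
    have h2 := hn₁ n ((le_max_left _ _).trans hn)
    have h3 := norm_sub_norm_le (z n) (z k)
    linarith

lemma ListsZeros.isZeroMultiset_singleton {f : ℂ → ℂ} {I : Set ℤ} {z : ℤ → ℂ}
    (hz : ListsZeros f I z) {n : ℤ} (hn : n ∈ I) {ρ : ℝ} (hρ : 0 ≤ ρ)
    (h : ∀ k ∈ I, k ≠ n → ρ < ‖z n - z k‖) :
    IsZeroMultiset f (Metric.closedBall (z n) ρ) {z n} := by
  refine ⟨fun x hx => ?_, fun c hc => ?_⟩
  · rw [Multiset.mem_singleton] at hx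
    rw [hx]; exact Metric.mem_closedBall_self hρ
  · rw [Metric.mem_closedBall, dist_comm, dist_eq_norm] at hc
    rw [← hz c]
    by_cases hcn : c = z n
    · have : {k : ℤ | k ∈ I ∧ z k = c} = {n} := by
        ext k
        constructor
        · rintro ⟨hk, hkc⟩
          by_contra hkn
          have := h k hk hkn
          rw [hkc, hcn, sub_self, norm_zero] at this
          exact hρ.not_gt this
        · rintro rfl
          exact ⟨hn, hcn.symm⟩
      rw [this, Set.encard_singleton, hcn, Multiset.count_singleton_self, Nat.cast_one]
    · have : {k : ℤ | k ∈ I ∧ z k = c} = ∅ := by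
        refine Set.eq_empty_of_forall_notMem ?_
        rintro k ⟨hk, rfl⟩
        have hkn : k ≠ n := fun h => hcn (by rw [h])
        exact hc.not_gt (h k hk hkn)
      rw [this, Set.encard_empty, Multiset.count_singleton, if_neg hcn, Nat.cast_zero]

/-- The quotient of `F` by z - z⁰ₙ is zero-free in a small disc, so the maximum principle for its
reciprocal carries the lower bound on the boundary circle inward. -/
lemma IsSineType.exists_mul_norm_sub_le {b : ℝ} (hb : 0 ≤ b) {F : ℂ → ℂ} (hF : IsSineType b F)
    {z₀ : ℤ → ℂ} {a : ℤ} (hz₀ : ListsZeros F (Set.Ici a) z₀) (hsep : AsymptoticallySeparated z₀) :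
    ∃ (n₁ : ℤ) (ρ c : ℝ), 0 < ρ ∧ 0 < c ∧ ∀ n z, n₁ ≤ n → ‖z - z₀ n‖ ≤ ρ →
      c * ‖z - z₀ n‖ ≤ ‖F z‖ := by
  obtain ⟨n₁, δ, hδ, hδn⟩ := hsep.exists_le_norm_sub a
  set ρ := δ / 4 with hρ
  have hρ0 : 0 < ρ := by positivity
  obtain ⟨c, hc, hcF⟩ := hF.exists_le_norm hb hz₀ hsep hρ0
  refine ⟨max n₁ a, ρ, c / ρ, hρ0, by positivity, fun n z hn hz => ?_⟩
  have hn₁ := (le_max_left _ _).trans hn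
  have hna := (le_max_right _ _).trans hn
  have hM := hz₀.isZeroMultiset_singleton (Set.mem_Ici.2 hna) hρ0.le fun k hk hkn =>
    lt_of_lt_of_le (by linarith) (hδn n k hn₁ hk hkn)
  obtain ⟨g, hg, hg0, hFg⟩ := hM.exists_eq_mul hF.entire hF.exists_ne (isCompact_closedBall _ _)
  have hFg' : ∀ u, F u = (u - z₀ n) * g u := fun u => by
    rw [hFg, rootProd, Multiset.map_singleton, Multiset.prod_singleton]
  have hinv : ∀ u ∈ Metric.closedBall (z₀ n) ρ, ‖(g u)⁻¹‖ ≤ ρ / c := by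
    intro u hu
    have hd : DiffContOnCl ℂ (fun u => (g u)⁻¹) (Metric.ball (z₀ n) ρ) := by
      refine DifferentiableOn.diffContOnCl fun u hu => ?_
      rw [closure_ball _ hρ0.ne'] at hu
      exact ((hg u).inv (hg0 u hu)).differentiableWithinAt
    rw [← closure_ball _ hρ0.ne'] at hu
    refine Complex.norm_le_of_forall_mem_frontier_norm_le Metric.isBounded_ball hd
      (fun v hv => ?_) hu
    rw [frontier_ball _ hρ0.ne'] at hv
    have hv0 := hg0 v (Metric.sphere_subset_closedBall hv)
    rw [mem_sphere_iff_norm] at hv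
    have h1 : c ≤ ‖F v‖ := by
      refine le_trans (le_mul_of_one_le_right hc.le (Real.one_le_exp (by positivity)))
        (hcF v fun k hk => ?_)
      rcases eq_or_ne k n with rfl | hkn
      · exact hv.ge
      · have h2 := hδn n k hn₁ hk hkn
        have h3 := norm_sub_le_norm_sub_add_norm_sub (z₀ n) v (z₀ k)
        rw [norm_sub_rev (z₀ n) v] at h3
        linarith
    rw [hFg', norm_mul, hv] at h1
    rw [norm_inv, inv_le_comm₀ (norm_pos_iff.2 hv0) (by positivity), inv_div, div_le_iff₀ hρ0]
    linarith
  have hzB : z ∈ Metric.closedBall (z₀ n) ρ := by rwa [mem_closedBall_iff_norm]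
  have h1 := hinv z hzB
  rw [norm_inv, inv_le_comm₀ (norm_pos_iff.2 (hg0 z hzB)) (by positivity), inv_div] at h1
  rw [hFg', norm_mul, mul_comm]
  exact mul_le_mul_of_nonneg_left h1 (norm_nonneg _)

/-- There are arbitrarily large circles around the origin that stay away from a separated sequence
in a horizontal strip. -/
lemma AsymptoticallySeparated.exists_radius {z : ℤ → ℂ} (hz : AsymptoticallySeparated z) {a : ℤ}
    {H : ℝ} (hH : ∀ n, a ≤ n → |(z n).im| ≤ H) :
    ∃ ε : ℝ, 0 < ε ∧ ∀ T : ℝ, ∃ R, T ≤ R ∧ ∀ n, a ≤ n → ε ≤ |‖z n‖ - R| := by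
  have hH0 : 0 ≤ H := (abs_nonneg _).trans (hH a le_rfl)
  obtain ⟨B, hB⟩ := hz.exists_encard_le a (2 * H + 1)
  -- Pigeonhole: within the strip, the annulus T < |z| < T + 1 is covered by two discs about ±T
  -- holding at most 2B terms, so one of 2B + 1 thinner annuli is free of them.
  set L : ℕ := 2 * B + 1 with hL
  have hL0 : (0 : ℝ) < L := by rw [hL]; positivity
  refine ⟨1 / (2 * L), by positivity, fun T₀ => ?_⟩
  set T := max T₀ H with hT
  have hTH : H ≤ T := le_max_right _ _
  by_contra! hcon
  have h1 : ∀ j : Fin L, ∃ n, a ≤ n ∧ |‖z n‖ - (T + (2 * j + 1) / (2 * L))| < 1 / (2 * L) :=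
    fun j => hcon _ ((le_max_left _ _).trans (le_add_of_nonneg_right (by positivity)))
  choose n hna hn using h1
  have h2 : ∀ j : Fin L, T + j / L < ‖z (n j)‖ ∧ ‖z (n j)‖ < T + (j + 1) / L := by
    intro j
    have h3 := abs_lt.1 (hn j)
    have e1 : (2 * (j : ℝ) + 1) / (2 * L) = j / L + 1 / (2 * L) := by field_simp
    have e2 : ((j : ℝ) + 1) / L = j / L + 1 / (2 * L) + 1 / (2 * L) := by field_simp; ring
    rw [e1] at h3
    rw [e2]
    constructor <;> linarith [h3.1, h3.2]
  have hinj : Function.Injective n := by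
    intro i j hij
    have hi := h2 i
    have hj := h2 j
    rw [hij] at hi
    have h3 : (i : ℝ) / L < (j + 1) / L := by linarith [hi.1, hj.2]
    have h4 : (j : ℝ) / L < (i + 1) / L := by linarith [hj.1, hi.2]
    rw [div_lt_div_iff_of_pos_right hL0] at h3 h4
    have h5 : (i : ℕ) < j + 1 := by exact_mod_cast h3
    have h6 : (j : ℕ) < i + 1 := by exact_mod_cast h4
    exact Fin.ext (by omega)
  have hsub : Set.range n ⊆ {n : ℤ | n ∈ Set.Ici a ∧ ‖z n - (T : ℂ)‖ ≤ 2 * H + 1} ∪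
      {n : ℤ | n ∈ Set.Ici a ∧ ‖z n - ((-T : ℝ) : ℂ)‖ ≤ 2 * H + 1} := by
    rintro _ ⟨j, rfl⟩
    have hj := h2 j
    have hj0 : (0 : ℝ) ≤ j / L := by positivity
    have hj1 : ((j : ℝ) + 1) / L ≤ 1 := by
      rw [div_le_one hL0]
      exact_mod_cast j.2
    have him := hH _ (hna j)
    have hre := Complex.abs_re_le_norm (z (n j))
    have hn1 := Complex.norm_le_abs_re_add_abs_im (z (n j))
    rcases abs_cases (z (n j)).re with ⟨h, _⟩ | ⟨h, _⟩
    · left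
      refine ⟨hna j, (Complex.norm_le_abs_re_add_abs_im _).trans ?_⟩
      simp only [Complex.sub_re, Complex.ofReal_re, Complex.sub_im, Complex.ofReal_im, sub_zero]
      have : |(z (n j)).re - T| ≤ H + 1 := abs_le.2 ⟨by linarith, by linarith⟩
      linarith
    · right
      refine ⟨hna j, (Complex.norm_le_abs_re_add_abs_im _).trans ?_⟩
      simp only [Complex.sub_re, Complex.ofReal_re, Complex.sub_im, Complex.ofReal_im, sub_zero]
      have : |(z (n j)).re - -T| ≤ H + 1 := abs_le.2 ⟨by linarith, by linarith⟩
      linarith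
  have h3 := (Set.encard_le_encard hsub).trans
    ((Set.encard_union_le _ _).trans (add_le_add (hB _) (hB _)))
  rw [← Set.image_univ, hinj.encard_image, Set.encard_univ, ENat.card_eq_coe_fintype_card,
    Fintype.card_fin] at h3
  have h4 : L ≤ B + B := by exact_mod_cast h3
  omega

/-! ### Polynomial growth, bounded fibres and finite numberings -/

lemma Polynomial.exists_mul_pow_le_norm_eval {P : Polynomial ℂ} {N : ℕ}
    (hP : P.degree = (N : WithBot ℕ)) :
    ∃ c T : ℝ, 0 < c ∧ ∀ z : ℂ, T ≤ ‖z‖ → c * ‖z‖ ^ N ≤ ‖P.eval z‖ := by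
  have hP0 : P ≠ 0 := by rintro rfl; simp at hP
  have hnat : P.natDegree = N := Polynomial.natDegree_eq_of_degree_eq_some hP
  have hs : P.Splits := IsAlgClosed.splits P
  have hcard : P.roots.card = N := by rw [← hnat, hs.natDegree_eq_card_roots]
  have hev : ∀ z, P.eval z = P.leadingCoeff * rootProd P.roots z := fun z => by
    rw [hs.eval_eq_prod_roots, rootProd]
  obtain ⟨D, hD⟩ := (P.roots.toFinset.finite_toSet.image fun a => ‖a‖).bddAbove
  refine ⟨‖P.leadingCoeff‖ * (1 / 2) ^ N, 2 * D, ?_, fun z hz => ?_⟩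
  · have := norm_pos_iff.2 (Polynomial.leadingCoeff_ne_zero.2 hP0)
    positivity
  · rw [hev, norm_mul, mul_assoc, ← mul_pow]
    refine mul_le_mul_of_nonneg_left ?_ (norm_nonneg _)
    rw [← hcard]
    refine le_norm_rootProd (by positivity) fun x hx => ?_
    have h1 := hD (Set.mem_image_of_mem (fun a => ‖a‖)
      (Finset.mem_coe.2 (Multiset.mem_toFinset.2 hx)))
    have h2 := norm_sub_norm_le z x
    linarith

lemma Summable.comp_of_encard_fiber_le {ι κ : Type*} {G : κ → ℝ}
    (hG : Summable G) (hG0 : ∀ k, 0 ≤ G k) {f : ι → κ} {B : ℕ}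
    (hf : ∀ k, {n | f n = k}.encard ≤ B) : Summable fun n => G (f n) := by
  classical
  refine summable_of_sum_le (c := B * ∑' k, G k) (fun n => hG0 _) fun s => ?_
  rw [Finset.sum_comp G f]
  refine le_trans (Finset.sum_le_sum (g := fun k => (B : ℝ) * G k) fun k _ => ?_) ?_
  · rw [nsmul_eq_mul]
    refine mul_le_mul_of_nonneg_right ?_ (hG0 k)
    have h1 : ((s.filter fun n => f n = k : Finset ι) : Set ι).encard ≤ B :=
      (Set.encard_le_encard fun n hn => (Finset.mem_filter.1 hn).2).trans (hf k)
    rw [Set.encard_coe_eq_coe_finsetCard] at h1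
    exact_mod_cast h1
  · rw [← Finset.mul_sum]
    exact mul_le_mul_of_nonneg_left (hG.sum_le_tsum _ fun k _ => hG0 k) (Nat.cast_nonneg B)

lemma Finset.exists_map_val_eq_of_card_eq {ι α : Type*} [Inhabited α] (s : Finset ι) :
    ∀ {M : Multiset α}, M.card = s.card → ∃ f : ι → α, s.val.map f = M := by
  classical
  induction s using Finset.induction_on with
  | empty =>
    intro M hM
    exact ⟨fun _ => default, by simpa using (Multiset.card_eq_zero.1 (by simpa using hM)).symm⟩
  | insert x s hx ih =>
    intro M hM
    rw [Finset.card_insert_of_notMem hx] at hM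
    obtain ⟨y, hy⟩ := Multiset.card_pos_iff_exists_mem.1 (show 0 < M.card by omega)
    obtain ⟨M', rfl⟩ := Multiset.exists_cons_of_mem hy
    obtain ⟨f, hf⟩ := ih (M := M') (by simpa using hM)
    refine ⟨Function.update f x y, ?_⟩
    rw [Finset.insert_val_of_notMem hx, Multiset.map_cons, Function.update_self, ← hf]
    congr 1
    refine Multiset.map_congr rfl fun n hn => Function.update_of_ne ?_ _ _
    rintro rfl
    exact hx hn

lemma Finset.exists_encard_fiber_eq_count (s : Finset ℤ) {M : Multiset ℂ} (hM : M.card = s.card) :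
    ∃ f : ℤ → ℂ, ∀ c, {n : ℤ | n ∈ s ∧ f n = c}.encard = (M.count c : ℕ∞) := by
  obtain ⟨f, hf⟩ := s.exists_map_val_eq_of_card_eq hM
  refine ⟨f, fun c => ?_⟩
  have h1 : {n : ℤ | n ∈ s ∧ f n = c} = ((s.filter fun n => c = f n : Finset ℤ) : Set ℤ) := by
    ext n
    simp [eq_comm]
  rw [h1, Set.encard_coe_eq_coe_finsetCard, ← hf, Multiset.count_map]
  rfl

/-! ### Numbering the zeros of a perturbation -/

/-- A perturbation of an entire function with asymptotically separated zeros in a horizontal strip,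
dominated by this function away from its zeros, has zeros that can be numbered asymptotically
close to the original ones. -/
theorem ListsZeros.exists_of_norm_sub_lt {G θ : ℂ → ℂ} (hG : Differentiable ℂ G)
    (hθ : Differentiable ℂ θ) {a : ℤ} {z₀ : ℤ → ℂ} (hz₀ : ListsZeros G (Set.Ici a) z₀)
    (hsep : AsymptoticallySeparated z₀) {H : ℝ} (hH : ∀ n, a ≤ n → |(z₀ n).im| ≤ H)
    (hdom : ∀ r : ℝ, 0 < r → ∃ T : ℝ, ∀ z : ℂ, T ≤ ‖z‖ → (∀ n, a ≤ n → r ≤ ‖z - z₀ n‖) →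
      ‖θ z - G z‖ < ‖G z‖) {ρ : ℝ} (hρ : 0 < ρ) :
    ∃ (z : ℤ → ℂ) (n₀ : ℤ), ListsZeros θ (Set.Ici a) z ∧ (∀ n, n₀ ≤ n → ‖z n - z₀ n‖ ≤ ρ) ∧
      Set.InjOn z (Set.Ici n₀) := by
  classical
  obtain ⟨n₁, δ, hδ, hδn⟩ := hsep.exists_le_norm_sub a
  obtain ⟨ε, hε, hεR⟩ := hsep.exists_radius hH
  -- The bound δ/4 makes the discs about distant zeros disjoint, with boundaries at distance at
  -- least r from every other zero; ε/2 keeps a move of size r from crossing the large circle.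
  set r := min ρ (min (δ / 4) (ε / 2)) with hr
  have hr0 : 0 < r := by positivity
  have hrρ : r ≤ ρ := min_le_left _ _
  have hrδ : r ≤ δ / 4 := (min_le_right _ _).trans (min_le_left _ _)
  have hrε : r ≤ ε / 2 := (min_le_right _ _).trans (min_le_right _ _)
  obtain ⟨T, hT⟩ := hdom r hr0
  obtain ⟨n₂, hn₂⟩ := hsep.exists_lt_norm (T + r)
  set n₀ := max a (max n₁ n₂) with hn₀
  have ha : a ≤ n₀ := le_max_left _ _
  have h1n : n₁ ≤ n₀ := (le_max_left _ _).trans (le_max_right _ _)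
  have h2n : n₂ ≤ n₀ := (le_max_right _ _).trans (le_max_right _ _)
  obtain ⟨D, hD⟩ := ((Set.finite_Ico a n₀).image fun k => ‖z₀ k‖).bddAbove
  have hD' : ∀ k, a ≤ k → k < n₀ → ‖z₀ k‖ ≤ D := fun k h1 h2 =>
    hD (Set.mem_image_of_mem (fun k => ‖z₀ k‖) (Set.mem_Ico.2 ⟨h1, h2⟩))
  obtain ⟨R, hR, hRε⟩ := hεR (max T (max D 1))
  have hRT : T ≤ R := (le_max_left _ _).trans hR
  have hRD : D ≤ R := (le_max_left _ _).trans ((le_max_right _ _).trans hR)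
  have hR0 : 0 < R := one_pos.trans_le ((le_max_right _ _).trans ((le_max_right _ _).trans hR))
  have hsphere : ∀ z ∈ Metric.sphere (0 : ℂ) R, ‖θ z - G z‖ < ‖G z‖ := by
    intro z hz
    rw [mem_sphere_zero_iff_norm] at hz
    refine hT z (hz ▸ hRT) fun n hn => ?_
    have h1 := hRε n hn
    have h2 := abs_norm_sub_norm_le (z₀ n) z
    rw [hz, norm_sub_rev] at h2
    linarith
  obtain ⟨p, hp⟩ : (Metric.sphere (0 : ℂ) R).Nonempty := NormedSpace.sphere_nonempty.2 hR0.le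
  have hGne : ∃ z, G z ≠ 0 := ⟨p, fun h => by
    have := hsphere p hp
    rw [h, norm_zero] at this
    exact (norm_nonneg _).not_gt this⟩
  have hθne : ∃ z, θ z ≠ 0 := ⟨p, fun h => by
    have := hsphere p hp
    rw [h, zero_sub, norm_neg] at this
    exact this.false⟩
  -- each distant zero of `G` has exactly one zero of `θ` nearby
  have hone : ∀ n, n₀ ≤ n → ∃ ζ, IsZeroMultiset θ (Metric.closedBall (z₀ n) r) {ζ} := by
    intro n hn
    obtain ⟨M, _, hM, _⟩ := exists_eq_rootProd_mul hθ hθne (isCompact_closedBall (z₀ n) r)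
    have hMG := hz₀.isZeroMultiset_singleton (Set.mem_Ici.2 (ha.trans hn)) hr0.le fun k hk hkn =>
      lt_of_lt_of_le (by linarith) (hδn n k (h1n.trans hn) hk hkn)
    have hcard := rouche_card_eq hr0 hθ hG (fun z hz => ?_) hM hMG
    · obtain ⟨ζ, rfl⟩ := Multiset.card_eq_one.1 (hcard.trans (Multiset.card_singleton _))
      exact ⟨ζ, hM⟩
    · rw [mem_sphere_iff_norm] at hz
      refine hT z ?_ fun k hk => ?_
      · have h1 := hn₂ n (h2n.trans hn)
        have h2 := norm_sub_norm_le (z₀ n) z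
        rw [norm_sub_rev, hz] at h2
        linarith
      · rcases eq_or_ne k n with rfl | hkn
        · exact hz.ge
        · have h2 := hδn n k (h1n.trans hn) hk hkn
          have h3 := norm_sub_le_norm_sub_add_norm_sub (z₀ n) z (z₀ k)
          rw [norm_sub_rev (z₀ n) z] at h3
          linarith
  choose! ζ hζ using hone
  have hζmem : ∀ n, n₀ ≤ n → ζ n ∈ Metric.closedBall (z₀ n) r := fun n hn =>
    (hζ n hn).mem _ (Multiset.mem_singleton_self _)
  have huniq : ∀ n k c, n₀ ≤ n → n₀ ≤ k → c ∈ Metric.closedBall (z₀ n) r →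
      c ∈ Metric.closedBall (z₀ k) r → k = n := by
    intro n k c hn hk hcn hck
    by_contra hkn
    have h2 := hδn n k (h1n.trans hn) (ha.trans hk) hkn
    have h3 := norm_sub_le_norm_sub_add_norm_sub (z₀ n) c (z₀ k)
    rw [mem_closedBall_iff_norm'] at hcn
    rw [mem_closedBall_iff_norm] at hck
    linarith
  have hfar : ∀ c, (∃ n, n₀ ≤ n ∧ c ∈ Metric.closedBall (z₀ n) r) →
      {k : ℤ | k ∈ Set.Ici n₀ ∧ ζ k = c}.encard = analyticOrderAt θ c := by
    rintro c ⟨n, hn, hc⟩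
    rw [(hζ n hn).count c hc, Multiset.count_singleton]
    split_ifs with h
    · have : {k : ℤ | k ∈ Set.Ici n₀ ∧ ζ k = c} = {n} := by
        ext k
        constructor
        · rintro ⟨hk, rfl⟩
          exact huniq n k _ hn hk hc (hζmem k hk)
        · rintro rfl
          exact ⟨hn, h.symm⟩
      rw [this, Set.encard_singleton, Nat.cast_one]
    · rw [Nat.cast_zero, Set.encard_eq_zero]
      refine Set.eq_empty_of_forall_notMem ?_
      rintro k ⟨hk, rfl⟩
      exact h (by rw [huniq n k _ hn hk hc (hζmem k hk)])
  have hnear : ∀ c, (¬ ∃ n, n₀ ≤ n ∧ c ∈ Metric.closedBall (z₀ n) r) →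
      {k : ℤ | k ∈ Set.Ici n₀ ∧ ζ k = c} = ∅ := by
    intro c hc
    refine Set.eq_empty_of_forall_notMem ?_
    rintro k ⟨hk, rfl⟩
    exact hc ⟨k, hk, hζmem k hk⟩
  -- the number of the remaining zeros of `θ`
  obtain ⟨M, _, hM, _⟩ := exists_eq_rootProd_mul hθ hθne (isCompact_closedBall 0 R)
  obtain ⟨M', _, hM', _⟩ := exists_eq_rootProd_mul hG hGne (isCompact_closedBall 0 R)
  have hcard := rouche_card_eq hR0 hθ hG hsphere hM hM'
  set p : ℂ → Prop := fun c => ∃ n, n₀ ≤ n ∧ c ∈ Metric.closedBall (z₀ n) r with hpdef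
  have hballs : {n : ℤ | n ∈ Set.Ici n₀ ∧ ζ n ∈ Metric.closedBall (0 : ℂ) R} =
      {n : ℤ | n ∈ Set.Ici n₀ ∧ z₀ n ∈ Metric.closedBall (0 : ℂ) R} := by
    ext n
    refine and_congr_right fun hn => ?_
    rw [mem_closedBall_zero_iff, mem_closedBall_zero_iff]
    have h1 := hRε n (ha.trans hn)
    have h2 := hζmem n hn
    rw [mem_closedBall_iff_norm] at h2
    have h3 := abs_le.1 ((abs_norm_sub_norm_le (ζ n) (z₀ n)).trans h2)
    rcases abs_cases (‖z₀ n‖ - R) with ⟨h, _⟩ | ⟨h, _⟩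
    · constructor <;> intro <;> linarith
    · constructor <;> intro <;> linarith
  have hfilter : {n : ℤ | n ∈ Set.Ici n₀ ∧ z₀ n ∈ Metric.closedBall (0 : ℂ) R}.encard =
      ((M.filter p).card : ℕ∞) := by
    rw [← hballs]
    refine encard_eq_card_of_count (fun c hc => hM.mem c (Multiset.mem_filter.1 hc).1)
      fun c hc => ?_
    rw [Multiset.count_filter]
    split_ifs with h
    · rw [hfar c h, hM.count c hc]
    · rw [hnear c h, Set.encard_empty, Nat.cast_zero]
  -- All z⁰ₖ with k < n₀ lie inside the large circle. Since the later indices contribute equally for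
  -- `G` and `θ`, Rouché leaves exactly n₀ - a zeros of `θ` outside the small discs.
  have htotal : (M'.card : ℕ∞) = ((Finset.Ico a n₀).card : ℕ∞) + ((M.filter p).card : ℕ∞) := by
    rw [← hz₀.encard_eq hM', ← hfilter, ← Set.encard_coe_eq_coe_finsetCard, ← Set.encard_union_eq]
    · congr 1
      ext n
      simp only [Finset.coe_Ico]
      constructor
      · rintro ⟨h1, h2⟩
        rcases lt_or_ge n n₀ with h3 | h3
        · exact Or.inl ⟨h1, h3⟩
        · exact Or.inr ⟨h3, h2⟩
      · rintro (⟨h1, h2⟩ | ⟨h1, h2⟩)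
        · exact ⟨h1, mem_closedBall_zero_iff.2 ((hD' n h1 h2).trans hRD)⟩
        · exact ⟨ha.trans h1, h2⟩
    · refine Set.disjoint_left.2 ?_
      rintro n h1 ⟨h2, _⟩
      rw [Finset.coe_Ico] at h1
      exact h1.2.not_ge h2
  have hrest : (M.filter fun c => ¬ p c).card = (Finset.Ico a n₀).card := by
    have h1 : M'.card = (Finset.Ico a n₀).card + (M.filter p).card := by exact_mod_cast htotal
    have h2 := congrArg Multiset.card (Multiset.filter_add_not p M)
    rw [Multiset.card_add] at h2
    omega
  obtain ⟨f, hf⟩ := (Finset.Ico a n₀).exists_encard_fiber_eq_count hrest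
  -- The leftover zeros are assigned to the initial indices in any order.
  refine ⟨fun n => if n < n₀ then f n else ζ n, n₀, fun c => ?_, fun n hn => ?_, ?_⟩
  · have hsplit : {n : ℤ | n ∈ Set.Ici a ∧ (if n < n₀ then f n else ζ n) = c} =
        {n : ℤ | n ∈ Finset.Ico a n₀ ∧ f n = c} ∪ {n : ℤ | n ∈ Set.Ici n₀ ∧ ζ n = c} := by
      ext n
      constructor
      · rintro ⟨h1, h2⟩
        rcases lt_or_ge n n₀ with h3 | h3
        · rw [if_pos h3] at h2
          exact Or.inl ⟨Finset.mem_Ico.2 ⟨h1, h3⟩, h2⟩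
        · rw [if_neg h3.not_gt] at h2
          exact Or.inr ⟨h3, h2⟩
      · rintro (⟨h1, h2⟩ | ⟨h1, h2⟩)
        · have h3 := Finset.mem_Ico.1 h1
          exact ⟨h3.1, by rw [if_pos h3.2]; exact h2⟩
        · exact ⟨ha.trans h1, by rw [if_neg (not_lt.2 h1)]; exact h2⟩
    rw [hsplit, Set.encard_union_eq, hf, Multiset.count_filter]
    · by_cases hc : p c
      · rw [if_neg (not_not.2 hc), Nat.cast_zero, zero_add, hfar c hc]
      · rw [if_pos hc, hnear c hc, Set.encard_empty, add_zero]
        by_cases hcR : c ∈ Metric.closedBall (0 : ℂ) R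
        · exact (hM.count c hcR).symm
        · rw [Multiset.count_eq_zero_of_notMem fun h => hcR (hM.mem c h), Nat.cast_zero, eq_comm,
            (hθ.analyticAt c).analyticOrderAt_eq_zero]
          intro hc0
          -- Beyond the large circle a zero of `θ` must be within r of some z⁰ₖ. As it avoids the
          -- small discs, k < n₀; but those z⁰ₖ lie at depth at least ε > r inside the circle.
          rw [mem_closedBall_zero_iff, not_le] at hcR
          obtain ⟨k, hk, hkc⟩ : ∃ k, a ≤ k ∧ ‖c - z₀ k‖ < r := by
            by_contra! hcon
            have := hT c (hRT.trans hcR.le) hcon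
            rw [hc0, zero_sub, norm_neg] at this
            exact this.false
          have hkn : k < n₀ := by
            by_contra hcon
            exact hc ⟨k, not_lt.1 hcon, mem_closedBall_iff_norm.2 hkc.le⟩
          have h1 := (hD' k hk hkn).trans hRD
          have h2 := hRε k hk
          rw [abs_of_nonpos (by linarith)] at h2
          have h3 := norm_sub_norm_le c (z₀ k)
          linarith
    · refine Set.disjoint_left.2 ?_
      rintro n ⟨h1, _⟩ ⟨h2, _⟩
      exact (Finset.mem_Ico.1 h1).2.not_ge h2
  · simp only [if_neg (not_lt.2 hn)]
    exact (mem_closedBall_iff_norm.1 (hζmem n hn)).trans hrρ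
  · intro n hn k hk hnk
    simp only [if_neg (not_lt.2 (Set.mem_Ici.1 hn)), if_neg (not_lt.2 (Set.mem_Ici.1 hk))] at hnk
    exact (huniq n k (ζ n) hn hk (hζmem n hn) (hnk ▸ hζmem k hk)).symm

/-! ### Domination of the Fourier term and the main theorem -/

lemma theta_eq (b : ℝ) (P : Polynomial ℂ) (S₀ : ℂ → ℂ) (w : ℝ → ℂ) (z : ℂ) :
    theta b P S₀ w z = P.eval z * S₀ z + entireFourier b w z := rfl

/-- Away from the zeros, the product of a polynomial and a sine-type function dominates the Fourier
transform of a square integrable function. -/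
lemma IsSineType.exists_entireFourier_lt {N : ℕ} {b : ℝ} (hb : 0 < b) {P : Polynomial ℂ}
    (hP : P.degree = (N : WithBot ℕ)) {S₀ : ℂ → ℂ} (hS₀ : IsSineType b S₀) {z₀ : ℤ → ℂ} {a : ℤ}
    (hz₀ : ListsZeros S₀ (Set.Ici a) z₀) (hsep : AsymptoticallySeparated z₀) {w : ℝ → ℂ}
    (hw : MemLp w 2 (volume.restrict (Set.Ioc (-b) b))) {r : ℝ} (hr : 0 < r) :
    ∃ T : ℝ, ∀ z : ℂ, T ≤ ‖z‖ → (∀ n, a ≤ n → r ≤ ‖z - z₀ n‖) →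
      ‖entireFourier b w z‖ < ‖P.eval z * S₀ z‖ := by
  obtain ⟨c₁, hc₁, h₁⟩ := hS₀.exists_le_norm hb.le hz₀ hsep hr
  obtain ⟨c₂, T₂, hc₂, h₂⟩ := Polynomial.exists_mul_pow_le_norm_eval hP
  obtain ⟨T, hT⟩ := exists_entireFourier_le hb hw (η := c₂ * c₁ / 2) (by positivity)
  refine ⟨max T (max T₂ 1), fun z hz hzn => ?_⟩
  have hz1 := (le_max_left _ _).trans hz
  have hz2 := (le_max_left _ _).trans ((le_max_right _ _).trans hz)
  have hz3 := (le_max_right _ _).trans ((le_max_right _ _).trans hz)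
  have hP1 : c₂ ≤ ‖P.eval z‖ :=
    (le_mul_of_one_le_right hc₂.le (one_le_pow₀ hz3)).trans (h₂ z hz2)
  have hexp := Real.exp_pos (b * |z.im|)
  calc ‖entireFourier b w z‖ ≤ c₂ * c₁ / 2 * Real.exp (b * |z.im|) := hT z hz1
    _ < c₂ * c₁ * Real.exp (b * |z.im|) :=
      mul_lt_mul_of_pos_right (half_lt_self (by positivity)) hexp
    _ = c₂ * (c₁ * Real.exp (b * |z.im|)) := mul_assoc _ _ _
    _ ≤ ‖P.eval z‖ * ‖S₀ z‖ := mul_le_mul hP1 (h₁ z hzn) (by positivity) (norm_nonneg _)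
    _ = ‖P.eval z * S₀ z‖ := (norm_mul _ _).symm

/-- The values of a square summable sequence at the indices of the points `π k / b` next to the
members of a separated sequence in a horizontal strip are square summable. -/
lemma AsymptoticallySeparated.summable_comp_round {z : ℤ → ℂ} (hz : AsymptoticallySeparated z)
    {a : ℤ} {H b : ℝ} (hb : 0 < b) (hH : ∀ n, a ≤ n → |(z n).im| ≤ H) {G : ℤ → ℝ}
    (hG : Summable G) (hG0 : ∀ k, 0 ≤ G k) :
    Summable fun n : Set.Ici a => G (round (b * (z n).re / Real.pi)) := by
  obtain ⟨B, hB⟩ := hz.exists_encard_le a (Real.pi / b + H)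
  refine hG.comp_of_encard_fiber_le hG0 (B := B) fun k => ?_
  refine le_trans ?_ (hB ((Real.pi * k / b : ℝ) : ℂ))
  rw [← (Subtype.val_injective (p := fun n => n ∈ Set.Ici a)).encard_image]
  refine Set.encard_le_encard ?_
  rintro _ ⟨n, hn, rfl⟩
  refine ⟨n.2, ?_⟩
  rw [← show round (b * (z n).re / Real.pi) = k from hn]
  exact norm_sub_round_le hb (hH n n.2)

theorem mainTheorem2 (N : ℕ) (b : ℝ) (hb : 0 < b)
    (P : Polynomial ℂ) (hP : P.degree = (N : WithBot ℕ))
    (S₀ : ℂ → ℂ) (hS₀ : IsSineType b S₀)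
    (z₀ : ℤ → ℂ)
    (hz₀ : ListsZeros S₀ (Set.Ici 1) z₀)
    (hz₀P : ListsZeros (fun z => P.eval z) (Set.Icc (1 - (N : ℤ)) 0) z₀)
    (hsep : AsymptoticallySeparated z₀)
    (w : ℝ → ℂ) (hw : MemLp w 2 (volume.restrict (Set.Ioo (-b) b))) :
    {z : ℂ | theta b P S₀ w z = 0}.Infinite ∧
    ∃ z ϰ : ℤ → ℂ,
      ListsZeros (theta b P S₀ w) (Set.Ici (1 - (N : ℤ))) z ∧
      (∀ n : ℤ, 1 - (N : ℤ) ≤ n → z n = z₀ n + ϰ n / mu z₀ n ^ N) ∧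
      Memℓp (fun n : Set.Ici (1 - (N : ℤ)) => ϰ n) 2 := by
  have hw' : MemLp w 2 (volume.restrict (Set.Ioc (-b) b)) := by
    rwa [← Measure.restrict_congr_set Ioo_ae_eq_Ioc]
  have hwi := MemLp.intervalIntegrable_of_restrict_Ioc hb hw'
  set a : ℤ := 1 - (N : ℤ) with ha
  have ha1 : a ≤ 1 := by omega
  have hPd : Differentiable ℂ fun z => P.eval z := P.differentiable
  have hGd : Differentiable ℂ fun z => P.eval z * S₀ z := hPd.mul hS₀.entire
  have hθd : Differentiable ℂ (theta b P S₀ w) := hGd.add (differentiable_entireFourier hb hwi)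
  have hzG : ListsZeros (fun z => P.eval z * S₀ z) (Set.Ici a) z₀ := by
    have hdisj : Disjoint (Set.Icc a 0) (Set.Ici 1) :=
      Set.disjoint_left.2 fun n h1 h2 => by
        have h3 := h1.2
        rw [Set.mem_Ici] at h2
        omega
    have h := hz₀P.mul hPd hS₀.entire hdisj hz₀
    have hU : Set.Icc a 0 ∪ Set.Ici 1 = Set.Ici a := by
      ext n
      simp only [Set.mem_union, Set.mem_Icc, Set.mem_Ici]
      omega
    rwa [hU] at h
  obtain ⟨H, hH⟩ : ∃ H : ℝ, ∀ n, a ≤ n → |(z₀ n).im| ≤ H := by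
    obtain ⟨K, hK⟩ := hS₀.exists_ne_zero
    obtain ⟨D, hD⟩ := ((Set.finite_Icc a 0).image fun k => |(z₀ k).im|).bddAbove
    refine ⟨max K D, fun n hn => ?_⟩
    rcases le_or_gt 1 n with h | h
    · refine le_trans (not_lt.1 fun hlt => ?_) (le_max_left _ _)
      exact hK _ hlt (hz₀.apply_eq_zero (Set.mem_Ici.2 h))
    · exact (hD (Set.mem_image_of_mem _ (Set.mem_Icc.2 ⟨hn, by omega⟩))).trans (le_max_right _ _)
  obtain ⟨n₃, ρ, c₃, hρ, hc₃, h₃⟩ := hS₀.exists_mul_norm_sub_le hb.le hz₀ hsep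
  obtain ⟨z, n₀, hz, hzρ, hinj⟩ := hzG.exists_of_norm_sub_lt hGd hθd hsep hH
    (fun r hr => by
      obtain ⟨T, hT⟩ := hS₀.exists_entireFourier_lt hb hP hz₀ hsep hw' hr
      refine ⟨T, fun z hzT hzr => ?_⟩
      rw [theta_eq, add_sub_cancel_left]
      exact hT z hzT fun n hn => hzr n (ha1.trans hn))
    (lt_min hρ one_pos)
  have hmu : ∀ n, mu z₀ n ≠ 0 := by
    intro n
    unfold mu
    split_ifs with h
    · exact neg_ne_zero.2 one_ne_zero
    · exact h
  -- The required identity forces this ϰ; only its square summability needs proof.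
  refine ⟨?_, z, fun n => (z n - z₀ n) * mu z₀ n ^ N, hz, fun n _ => ?_, ?_⟩
  · have h1 : (z '' Set.Ici (max a n₀)).Infinite :=
      (Set.Ici_infinite _).image (hinj.mono (Set.Ici_subset_Ici.2 (le_max_right _ _)))
    refine h1.mono ?_
    rintro _ ⟨n, hn, rfl⟩
    exact hz.apply_eq_zero (Set.mem_Ici.2 ((le_max_left _ _).trans hn))
  · rw [mul_div_cancel_right₀ _ (pow_ne_zero N (hmu n)), add_sub_cancel]
  · obtain ⟨c₂, T₂, hc₂, h₂⟩ := Polynomial.exists_mul_pow_le_norm_eval hP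
    obtain ⟨n₄, hn₄⟩ := hsep.exists_lt_norm (max 2 (T₂ + 1))
    have hH0 : 0 ≤ H := (abs_nonneg _).trans (hH a le_rfl)
    -- The radius covers the distance from zₙ to z⁰ₙ, at most 1, plus that from z⁰ₙ to its nearest
    -- lattice point.
    obtain ⟨g, hg0, hgs, hg⟩ := exists_summable_sq_bound hb hw' (R := 1 + (Real.pi / b + H))
      (by have := Real.pi_pos; positivity)
    -- The factor 2^N comes from |zₙ| ≥ |z⁰ₙ|/2; c₂ and c₃ are the lower constants for P and S₀.
    set C := 2 ^ N / (c₂ * c₃) with hC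
    have hsum := (hsep.summable_comp_round hb hH hgs fun k => sq_nonneg _).mul_left (C ^ 2)
    refine memℓp_gen ?_
    simp only [ENNReal.toReal_ofNat, Real.rpow_two]
    refine Summable.of_norm_bounded_eventually hsum ?_
    set n₅ := max (max n₀ n₃) n₄ with hn₅
    refine Set.Finite.subset ((Set.finite_Ico a n₅).preimage Subtype.val_injective.injOn)
      fun n hn => ?_
    refine ⟨n.2, ?_⟩
    by_contra hcon
    rw [not_lt] at hcon
    refine hn ?_
    have hn0 : n₀ ≤ n := (le_max_left _ _).trans ((le_max_left _ _).trans hcon)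
    have hn3 : n₃ ≤ n := (le_max_right _ _).trans ((le_max_left _ _).trans hcon)
    have hn4 := hn₄ n ((le_max_right _ _).trans hcon)
    have hz2 : 2 < ‖z₀ n‖ := (le_max_left _ _).trans_lt hn4
    have hzT : T₂ + 1 < ‖z₀ n‖ := (le_max_right _ _).trans_lt hn4
    have hzn := hzρ n hn0
    have hzn1 : ‖z n - z₀ n‖ ≤ 1 := hzn.trans (min_le_right _ _)
    have htri := norm_sub_norm_le (z₀ n) (z n)
    rw [norm_sub_rev] at htri
    have hθ0 : P.eval (z n) * S₀ (z n) + entireFourier b w (z n) = 0 := hz.apply_eq_zero n.2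
    have hmun : mu z₀ n = z₀ n := by
      unfold mu
      rw [if_neg]
      intro h
      rw [h, norm_zero] at hz2
      linarith
    have hS := h₃ n (z n) hn3 (hzn.trans (min_le_left _ _))
    have hPz : c₂ * (‖z₀ n‖ / 2) ^ N ≤ ‖P.eval (z n)‖ := by
      refine le_trans ?_ (h₂ (z n) (by linarith))
      refine mul_le_mul_of_nonneg_left (pow_le_pow_left₀ (by positivity) ?_ N) hc₂.le
      linarith
    have hgz : ‖entireFourier b w (z n)‖ ≤ g (round (b * (z₀ n).re / Real.pi)) := by
      refine hg _ _ ?_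
      refine (norm_sub_le_norm_sub_add_norm_sub _ (z₀ n) _).trans (add_le_add hzn1 ?_)
      exact norm_sub_round_le hb (hH n n.2)
    -- At a zero of `θ` the product P S₀ equals minus the Fourier term, so the two lower bounds
    -- multiply against the ℓ² bound.
    have hprod : c₂ * (‖z₀ n‖ / 2) ^ N * (c₃ * ‖z n - z₀ n‖) ≤
        g (round (b * (z₀ n).re / Real.pi)) := by
      refine le_trans (mul_le_mul hPz hS (by positivity) (norm_nonneg _)) ?_
      rw [← norm_mul, eq_neg_of_add_eq_zero_left hθ0, norm_neg]
      exact hgz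
    have hκ : ‖(z n - z₀ n) * mu z₀ n ^ N‖ ≤ C * g (round (b * (z₀ n).re / Real.pi)) := by
      rw [hmun, norm_mul, norm_pow, hC, div_mul_eq_mul_div, le_div_iff₀ (by positivity)]
      refine le_trans (le_of_eq ?_) (mul_le_mul_of_nonneg_left hprod (by positivity))
      rw [div_pow]
      field_simp
    change ‖‖(z n - z₀ n) * mu z₀ n ^ N‖ ^ 2‖ ≤
      C ^ 2 * g (round (b * (z₀ n).re / Real.pi)) ^ 2
    rw [Real.norm_eq_abs, abs_of_nonneg (sq_nonneg _), ← mul_pow]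
    exact pow_le_pow_left₀ (norm_nonneg _) hκ 2
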